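/- Let $X_1,\dots,X_n$ be variables with finite, linearly ordered domains, let $G$ be a directed acyclic graph on them, with parent sets $PA_i$, and let $\mathcal D$ be a list of $t\ge 2$ full assignments (a data set). The empirical Bayesian network $empBN(G,\mathcal D)$ is the graphical model with the $n$ functions $P_{\mathcal D}(x_i\mid pa_i)=\#\mathcal D(x_i,pa_i)/\#\mathcal D(pa_i)$, of scopes $\{X_i\}\cup PA_i$, where $\#\mathcal D(s)$ is the number of elements of $\mathcal D$ that agree with $s$, and the value is $0$ if $\#\mathcal D(pa_i)=0$. A hypertree decomposition of a graphical model is a tree $T$ whose vertices $v$ carry a set $\chi(v)$ of variables and a set $\psi(v)$ of functions, such that (1) every function is in $\psi(v)$ for exactly one $v$; (2) the scope of each function in $\psi(v)$ is contained in $\chi(v)$; (3) for each variable, the vertices $v$ with that variable in $\chi(v)$ induce a connected subgraph of $T$; (4) $\chi(v)$ is contained in the union of the scopes of the functions in $\psi(v)$. Its width is $\max_v|\psi(v)|$, and the hypertree width of the model is the minimal width of its hypertree decompositions. A sum-product query consists of a set $X$ of variables that is contained in the scope of some function of the model, an event $W=w$ and, optionally, a condition $Y=y$, where $W$ and $Y$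 are arbitrary sets of variables. It asks for the function $x\mapsto \Sigma(X=x,W=w)$ or, if there is a condition, for $x\mapsto P(X=x,W=w\mid Y=y):=\Sigma(X=x,W=w,Y=y)/\Sigma(Y=y)$ (zero if the denominator is zero), where $\Sigma(A)$ is the sum, over all full assignments consistent with $A$, of the product of all functions of the model. (With $X=\emptyset$ this covers every number $P(W=w\mid Y=y)$.) The answer is given relationally, as the list of all pairs of an assignment $x$ to $X$ and its value, for the $x$ with non-zero value, each $x$ once. Computations are performed by a fixed first-order recursive program over pairs (pointer structures). Every elementary step has unit cost; besides pairing, taking components, tests for the empty structure, variable bindings and function calls, the elementary operations are: addition, multiplication and division of numbers; lexicographic comparison of two tuples (partial assignments); projection of a tuple to a set of variables; the set of variables of a tuple; intersection of two sets of variables. **Statement.** There are one such program and one constant $C$ with the following property. For all $n$, all domains, all $G$ and all $\mathcal D$ as above such that $empBN(G,\mathcal D)$ has hypertree width $1$, and for every sum-product query over $empBN(G,\mathcal D)$ as above: there is a hypertree decomposition of width $1$ with at most $n$ vertices, with a vertex $r$ such that $X\subseteq\chi(r)$; and, given the data set $\mathcal D$, any such decomposition (as a tree rooted at any such $r$, each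 vertex being labelled with $\chi(v)$ and with the sets $\{X_i\}\cup PA_i$ and $PA_i$ of the functions in $\psi(v)$) and the query, the program outputs the answer after at most $$C\cdot n\cdot t\log t$$ steps. -/

import Mathlib

namespace EmpBN

noncomputable section

/-! ### Graphical models, hypertree decompositions, sum-product queries -/

/-- A full assignment to the variables `0, …, n - 1`, the `i`-th with domain `D i`. -/
abbrev Assignment {n : ℕ} (D : Fin n → Type) : Type := ∀ i, D i

/-- A tuple: an assignment to some of the variables; `⊥` marks an unassigned variable. -/
abbrev PTuple {n : ℕ} (D : Fin n → Type) : Type := ∀ i, WithBot (D i)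

/-- The set of variables assigned by a tuple. -/
def PTuple.dom {n : ℕ} {D : Fin n → Type} (p : PTuple D) : Finset (Fin n) :=
  open Classical in Finset.univ.filter (fun i => p i ≠ ⊥)

/-- The projection of a tuple to a set of variables. -/
def PTuple.restrict {n : ℕ} {D : Fin n → Type} (p : PTuple D) (S : Finset (Fin n)) : PTuple D :=
  fun i => if i ∈ S then p i else ⊥

/-- A full assignment, seen as a tuple. -/
def Assignment.toPTuple {n : ℕ} {D : Fin n → Type} (z : Assignment D) : PTuple D :=
  fun i => (z i : WithBot (D i))

/-- The full assignments that are consistent with a tuple. -/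
def PTuple.ext {n : ℕ} {D : Fin n → Type} (p : PTuple D) : Set (Assignment D) :=
  {z | ∀ i, p i ≠ ⊥ → p i = (z i : WithBot (D i))}

/-- A graphical model with `r` real-valued functions; the `j`-th one depends only on the
variables in `scope j`. -/
structure GraphicalModel {n : ℕ} (D : Fin n → Type) (r : ℕ) where
  scope : Fin r → Finset (Fin n)
  f : Fin r → Assignment D → ℝ
  congr_scope : ∀ j z z', (∀ i ∈ scope j, z i = z' i) → f j z = f j z'

/-- A hypertree decomposition `⟨T, χ, ψ⟩` of a graphical model, with tree vertices `ι`. -/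
structure HypertreeDecomposition {n : ℕ} {D : Fin n → Type} {r : ℕ} (M : GraphicalModel D r)
    (ι : Type) where
  T : SimpleGraph ι
  isTree : T.IsTree
  χ : ι → Finset (Fin n)
  ψ : ι → Finset (Fin r)
  exists_unique : ∀ j, ∃! v, j ∈ ψ v
  scope_subset : ∀ v, ∀ j ∈ ψ v, M.scope j ⊆ χ v
  running_intersection : ∀ i, (T.induce {v | i ∈ χ v}).Preconnected
  cover : ∀ v, χ v ⊆ (ψ v).biUnion M.scope

/-- The hypertree width of a decomposition: the largest number of functions at a vertex. -/
def HypertreeDecomposition.width {n : ℕ} {D : Fin n → Type} {r : ℕ} {M : GraphicalModel D r}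
    {ι : Type} [Fintype ι] (τ : HypertreeDecomposition M ι) : ℕ :=
  Finset.univ.sup (fun v => (τ.ψ v).card)

/-- The hypertree width of a graphical model: the minimum over its hypertree decompositions. -/
def GraphicalModel.hypertreeWidth {n : ℕ} {D : Fin n → Type} {r : ℕ} (M : GraphicalModel D r) :
    ℕ :=
  sInf {w | ∃ (m : ℕ) (τ : HypertreeDecomposition M (Fin m)), τ.width = w}

/-- The sum, over the full assignments in `A`, of the product of all functions of the model. -/
def GraphicalModel.sumProduct {n : ℕ} {D : Fin n → Type} [∀ i, Fintype (D i)] {r : ℕ}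
    (M : GraphicalModel D r) (A : Set (Assignment D)) : ℝ :=
  open Classical in ∑ z : Assignment D, if z ∈ A then ∏ j, M.f j z else 0

/-- A sum-product query.  With `X = target`, the event `W = w` and the condition `Y = y`, it asks
for the function `x ↦ P(X = x, W = w | Y = y)`; with `given = none`, it asks for the plain sum of
products `x ↦ ∑ ∏`, over all full assignments that are consistent with `X = x` and `W = w`. -/
structure Query {n : ℕ} (D : Fin n → Type) where
  target : Finset (Fin n)
  event : PTuple D
  given : Option (PTuple D)

/-- The function that answers a query, on a tuple `x` over the target variables. (A conditional
probability given an event of probability zero is zero.) -/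
def GraphicalModel.answer {n : ℕ} {D : Fin n → Type} [∀ i, Fintype (D i)] {r : ℕ}
    (M : GraphicalModel D r) (q : Query D) (x : PTuple D) : ℝ :=
  match q.given with
  | none => M.sumProduct (x.ext ∩ q.event.ext)
  | some y => M.sumProduct (x.ext ∩ q.event.ext ∩ y.ext) / M.sumProduct y.ext

/-- `l` is the relational representation of the function `g` over the variables `S`: it lists,
once each, the tuples over `S` with a non-zero value, together with this value. -/
def IsRelation {n : ℕ} {D : Fin n → Type} (S : Finset (Fin n)) (g : PTuple D → ℝ)
    (l : List (PTuple D × ℝ)) : Prop :=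
  (l.map Prod.fst).Nodup ∧ ∀ x a, (x, a) ∈ l ↔ x.dom = S ∧ g x = a ∧ a ≠ 0

/-! ### The empirical Bayesian network -/

/-- A directed graph without directed cycles. -/
def IsDAG {V : Type} (G : Digraph V) : Prop := ∀ v, ¬ Relation.TransGen G.Adj v v

def parents {n : ℕ} (G : Digraph (Fin n)) (i : Fin n) : Finset (Fin n) :=
  open Classical in Finset.univ.filter (fun j => G.Adj j i)

/-- A variable together with its parents. -/
def family {n : ℕ} (G : Digraph (Fin n)) (i : Fin n) : Finset (Fin n) := insert i (parents G i)

/-- The number of rows of the data that agree with `z` on the variables in `S`. -/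
def count {n : ℕ} {D : Fin n → Type} (data : List (Assignment D)) (S : Finset (Fin n))
    (z : Assignment D) : ℕ :=
  open Classical in data.countP (fun d => decide (∀ i ∈ S, d i = z i))

theorem count_congr {n : ℕ} {D : Fin n → Type} (data : List (Assignment D)) (S : Finset (Fin n))
    (z z' : Assignment D) (h : ∀ i ∈ S, z i = z' i) : count data S z = count data S z' := by
  unfold count
  congr 1
  funext d
  exact decide_eq_decide.mpr (forall₂_congr fun i hi => by rw [h i hi])

/-- The empirical Bayesian network of a data set over a directed graph: its `i`-th function is the
empirical conditional probability table `#(x_i, pa_i) / #(pa_i)`, which is zero where the parent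
configuration does not occur in the data. -/
def empBN {n : ℕ} {D : Fin n → Type} (G : Digraph (Fin n)) (data : List (Assignment D)) :
    GraphicalModel D n where
  scope := family G
  f := fun i z => (count data (family G i) z : ℝ) / (count data (parents G i) z : ℝ)
  congr_scope := by
    intro j z z' h
    have h1 := count_congr data (family G j) z z' h
    have h2 := count_congr data (parents G j) z z'
      (fun i hi => h i (Finset.mem_insert_of_mem hi))
    simp only [h1, h2]

/-! ### The machine model

First-order recursive programs over pointer structures.  A datum is a number, a tuple, a set of
variables, the empty structure, or a pair of pointers.  A program is a finite list of function
bodies; it depends neither on the number of variables nor on their domains.  Each evaluation of a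
subexpression takes one step. -/

inductive Val {n : ℕ} (D : Fin n → Type) : Type
  | nil : Val D
  | cons : Val D → Val D → Val D
  | num : ℝ → Val D
  | tup : PTuple D → Val D
  | vars : Finset (Fin n) → Val D

/-- A list, as a chain of pairs. -/
def Val.list {n : ℕ} {D : Fin n → Type} : List (Val D) → Val D
  | [] => Val.nil
  | a :: l => Val.cons a (Val.list l)

/-- Unary operations: the components of a pair, the set of variables of a tuple. -/
inductive Op1 : Type
  | fst | snd | dom

/-- Binary operations: pairing, arithmetic, intersection of two sets of variables, projection of a
tuple to a set of variables, lexicographic comparison of two tuples. -/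
inductive Op2 : Type
  | pair | plus | times | over | inter | restrict | le

def Op1.apply {n : ℕ} {D : Fin n → Type} : Op1 → Val D → Option (Val D)
  | .fst, .cons a _ => some a
  | .snd, .cons _ b => some b
  | .dom, .tup p => some (.vars p.dom)
  | _, _ => none

def Op2.apply {n : ℕ} {D : Fin n → Type} [∀ i, LinearOrder (D i)] :
    Op2 → Val D → Val D → Option (Val D)
  | .pair, a, b => some (.cons a b)
  | .plus, .num a, .num b => some (.num (a + b))
  | .times, .num a, .num b => some (.num (a * b))
  | .over, .num a, .num b => open Classical in if b = 0 then none else some (.num (a / b))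
  | .inter, .vars S, .vars S' => some (.vars (S ∩ S'))
  | .restrict, .tup p, .vars S => some (.tup (p.restrict S))
  | .le, .tup p, .tup p' =>
      open Classical in some (if toLex p ≤ toLex p' then .num 1 else .nil)
  | _, _, _ => none

inductive Expr : Type
  /-- the value of the `i`-th most recently bound variable -/
  | var (i : ℕ)
  | nil
  | const (k : ℕ)
  | op1 (o : Op1) (e : Expr)
  | op2 (o : Op2) (e₁ e₂ : Expr)
  /-- if `c` is not `nil` then `a` else `b` -/
  | ite (c a b : Expr)
  /-- evaluate `e`, bind its value, evaluate `b` -/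
  | bind (e b : Expr)
  /-- call the `k`-th function of the program -/
  | call (k : ℕ) (e : Expr)

abbrev Program : Type := List Expr

/-- `Eval P env e v c`: with the functions of `P`, and the values `env` of the bound variables, the
expression `e` evaluates to `v` in exactly `c` steps. -/
inductive Eval {n : ℕ} {D : Fin n → Type} [∀ i, LinearOrder (D i)] (P : Program) :
    List (Val D) → Expr → Val D → ℕ → Prop
  | var {env i v} : env[i]? = some v → Eval P env (.var i) v 1
  | nil {env} : Eval P env .nil .nil 1
  | const {env k} : Eval P env (.const k) (.num (k : ℝ)) 1
  | op1 {env o e a v c} : Eval P env e a c → o.apply a = some v →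
      Eval P env (.op1 o e) v (c + 1)
  | op2 {env o e₁ e₂ a b v c₁ c₂} : Eval P env e₁ a c₁ → Eval P env e₂ b c₂ →
      o.apply a b = some v → Eval P env (.op2 o e₁ e₂) v (c₁ + c₂ + 1)
  | ite_true {env e a b u v c₁ c₂} : Eval P env e u c₁ → u ≠ .nil → Eval P env a v c₂ →
      Eval P env (.ite e a b) v (c₁ + c₂ + 1)
  | ite_false {env e a b v c₁ c₂} : Eval P env e .nil c₁ → Eval P env b v c₂ →
      Eval P env (.ite e a b) v (c₁ + c₂ + 1)
  | bind {env e b u v c₁ c₂} : Eval P env e u c₁ → Eval P (u :: env) b v c₂ →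
      Eval P env (.bind e b) v (c₁ + c₂ + 1)
  | call {env k e body u v c₁ c₂} : Eval P env e u c₁ → P[k]? = some body →
      Eval P [u] body v c₂ → Eval P env (.call k e) v (c₁ + c₂ + 1)

/-- The program, started with its first function, turns `input` into `output` in `c` steps. -/
def Program.Runs {n : ℕ} {D : Fin n → Type} [∀ i, LinearOrder (D i)] (P : Program)
    (input output : Val D) (c : ℕ) : Prop :=
  Eval P [input] (.call 0 (.var 0)) output c

/-! ### Encoding of inputs and outputs -/

def encodeData {n : ℕ} {D : Fin n → Type} (data : List (Assignment D)) : Val D :=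
  Val.list (data.map fun d => Val.tup d.toPTuple)

def encodeQuery {n : ℕ} {D : Fin n → Type} (q : Query D) : Val D :=
  .cons (.vars q.target) (.cons (.tup q.event)
    (match q.given with
      | none => .nil
      | some y => .tup y))

def encodeRelation {n : ℕ} {D : Fin n → Type} (l : List (PTuple D × ℝ)) : Val D :=
  Val.list (l.map fun e => Val.cons (.tup e.1) (.num e.2))

/-- `EncodesForest T L p cs x`: the value `x` is a list that holds, for every vertex `c` in `cs`, a
label of `c` paired with an encoding (of the same kind) of the subtrees that hang below `c`, the
neighbours of `c` other than its own parent `p`. -/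
inductive EncodesForest {n : ℕ} {D : Fin n → Type} {ι : Type} (T : SimpleGraph ι)
    (L : ι → Val D → Prop) : ι → List ι → Val D → Prop
  | nil {p} : EncodesForest T L p [] .nil
  | cons {p c cs ds a x y} : ds.Nodup → (∀ d, d ∈ ds ↔ T.Adj c d ∧ d ≠ p) → L c a →
      EncodesForest T L c ds x → EncodesForest T L p cs y →
      EncodesForest T L p (c :: cs) (.cons (.cons a x) y)

/-- `x` encodes the tree `T`, rooted at `r`, with labels `L`. -/
def EncodesTree {n : ℕ} {D : Fin n → Type} {ι : Type} (T : SimpleGraph ι)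
    (L : ι → Val D → Prop) (r : ι) (x : Val D) : Prop :=
  ∃ cs a y, cs.Nodup ∧ (∀ d, d ∈ cs ↔ T.Adj r d) ∧ L r a ∧ EncodesForest T L r cs y ∧
    x = .cons a y

/-- The label of a vertex: `χ v`, and a list of the functions in `ψ v`, each one given by its
family and its parents. -/
def EncodesVertex {n : ℕ} {D : Fin n → Type} (G : Digraph (Fin n)) {ι : Type}
    (χ ψ : ι → Finset (Fin n)) (v : ι) (a : Val D) : Prop :=
  ∃ l : List (Fin n), l.Nodup ∧ (∀ i, i ∈ l ↔ i ∈ ψ v) ∧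
    a = .cons (.vars (χ v))
      (Val.list (l.map fun i => .cons (.vars (family G i)) (.vars (parents G i))))

/-- `x` encodes a hypertree decomposition of width 1 of the empirical Bayesian network, with at
most `n` vertices, rooted at a vertex whose cluster contains the variables `X`. -/
def IsRootedDecomposition {n : ℕ} {D : Fin n → Type} (G : Digraph (Fin n))
    (data : List (Assignment D)) (X : Finset (Fin n)) (x : Val D) : Prop :=
  ∃ (m : ℕ) (τ : HypertreeDecomposition (empBN G data) (Fin m)) (r : Fin m),
    m ≤ n ∧ τ.width = 1 ∧ X ⊆ τ.χ r ∧ EncodesTree τ.T (EncodesVertex G τ.χ τ.ψ) r x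

end

end EmpBN

/-! Width one and at most `n` vertices force every vertex to carry exactly one function: the `n`
functions sit at distinct vertices, and by the covering condition the cluster of a vertex is the
family of its variable. The decomposition is thus a join tree of the families
(`IsRootedDecomposition.exists_isJoinTree`). A conditional probability table is non-zero only on
projections of data rows, so as a relation it has at most `t` rows; sorting the data by projection,
adding up equal keys and merging produces it in `O(t log t)` steps (`eval_table`).

The query is answered by passing messages towards the root. A vertex multiplies its table by the
messages of its children and sums out the variables that it does not share with its parent. The
variables of a message lie in the family that receives it, so the multiplication is a merge join
that rescales or drops rows and never creates any (`Represents.eval_join`). Hence every intermediate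
relation keeps at most `t` rows, and each of the `n` vertices costs `O(t log t)`
(`JoinForest.eval`). Correctness is the distributive law for `marg`, applied to the separators that
the running intersection property provides (`marg_message`, `marg_mul_marg`).

Evidence enters as 0/1 indicators multiplied into every table. Each variable belongs to its own
family, so the product of all indicators detects every conflict (`evidenceProd_eq`). The root
relation is finally summed down to the target; for a conditional query a second pass, with the
condition alone, gives the denominator.

For the existence of a decomposition, vertices without a function have empty clusters and can be
dropped; the forest that remains is completed to a tree
(`HypertreeDecomposition.exists_index_functions`). -/

namespace EmpBN

noncomputable section

/-! ### The program -/

namespace Expr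

abbrev fst (e : Expr) : Expr := .op1 .fst e
abbrev snd (e : Expr) : Expr := .op1 .snd e
abbrev pair (a b : Expr) : Expr := .op2 .pair a b

end Expr

open EmpBN.Expr

/-- Split a list into two halves. -/
def splitBody : Expr :=
  .ite (.var 0)
    (.bind (.call 1 (snd (.var 0)))
      (pair (pair (fst (.var 1)) (snd (.var 0))) (fst (.var 0))))
    (pair .nil .nil)

/-- Merge two lists that are sorted by key. -/
def mergeBody : Expr :=
  .ite (fst (.var 0))
    (.ite (snd (.var 0))
      (.ite (.op2 .le (fst (fst (fst (.var 0)))) (fst (fst (snd (.var 0)))))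
        (pair (fst (fst (.var 0))) (.call 2 (pair (snd (fst (.var 0))) (snd (.var 0)))))
        (pair (fst (snd (.var 0))) (.call 2 (pair (fst (.var 0)) (snd (snd (.var 0)))))))
      (fst (.var 0)))
    (snd (.var 0))

/-- Sort a list by key. -/
def sortBody : Expr :=
  .ite (.var 0)
    (.ite (snd (.var 0))
      (.bind (.call 1 (.var 0))
        (.call 2 (pair (.call 3 (fst (.var 0))) (.call 3 (snd (.var 0))))))
      (.var 0))
    .nil

/-- Add up the values with equal keys in a sorted keyed list. -/
def groupBody : Expr :=
  .ite (.var 0)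
    (.bind (.call 4 (snd (.var 0)))
      (.ite (.var 0)
        (.ite (.op2 .le (fst (fst (.var 0))) (fst (fst (.var 1))))
          (pair (pair (fst (fst (.var 0)))
            (.op2 .plus (snd (snd (fst (.var 1)))) (snd (fst (.var 0))))) (snd (.var 0)))
          (pair (pair (fst (fst (.var 1))) (snd (snd (fst (.var 1))))) (.var 0)))
        (pair (pair (fst (fst (.var 1))) (snd (snd (fst (.var 1))))) .nil)))
    .nil

/-- Multiply the values in a sorted keyed list by the values of the keys in a sorted relation. -/
def joinBody : Expr :=
  .ite (fst (.var 0))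
    (.ite (snd (.var 0))
      (.ite (.op2 .le (fst (fst (fst (.var 0)))) (fst (fst (snd (.var 0)))))
        (.ite (.op2 .le (fst (fst (snd (.var 0)))) (fst (fst (fst (.var 0)))))
          (pair (pair (fst (snd (fst (fst (.var 0)))))
              (.op2 .times (snd (snd (fst (fst (.var 0))))) (snd (fst (snd (.var 0))))))
            (.call 5 (pair (snd (fst (.var 0))) (snd (.var 0)))))
          (.call 5 (pair (snd (fst (.var 0))) (snd (.var 0)))))
        (.call 5 (pair (fst (.var 0)) (snd (snd (.var 0))))))
      .nil)
    .nil

/-- Attach to the rows of a relation their projections to a set of variables, as keys. -/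
def rekeyBody : Expr :=
  .ite (fst (.var 0))
    (pair (pair (.op2 .restrict (fst (fst (fst (.var 0)))) (snd (.var 0))) (fst (fst (.var 0))))
      (.call 6 (pair (snd (fst (.var 0))) (snd (.var 0)))))
    .nil

/-- Take the reciprocals of the values of a relation. -/
def recipBody : Expr :=
  .ite (.var 0)
    (pair (pair (fst (fst (.var 0))) (.op2 .over (.const 1) (snd (fst (.var 0)))))
      (.call 7 (snd (.var 0))))
    .nil

/-- Give every tuple of a list the value one. -/
def onesBody : Expr :=
  .ite (.var 0)
    (pair (pair (fst (.var 0)) (.const 1)) (.call 8 (snd (.var 0))))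
    .nil

/-- The sum of the values of a relation. -/
def totalBody : Expr :=
  .ite (.var 0)
    (.op2 .plus (snd (fst (.var 0))) (.call 9 (snd (.var 0))))
    (.const 0)

/-- Divide the values of a relation by a number. -/
def divideBody : Expr :=
  .ite (fst (.var 0))
    (pair (pair (fst (fst (fst (.var 0)))) (.op2 .over (snd (fst (fst (.var 0)))) (snd (.var 0))))
      (.call 10 (pair (snd (fst (.var 0))) (snd (.var 0)))))
    .nil

/-- Sort a relation by the projections of its rows to a set of variables. -/
def indexBody : Expr := .call 3 (.call 6 (.var 0))

/-- Sum a relation out to a set of variables. -/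
def marginalBody : Expr := .call 4 (.call 11 (.var 0))

/-- Keep the rows of a relation that are consistent with a tuple. The argument consists of the
relation, the tuple and the variables of the relation. -/
def filterBody : Expr :=
  .call 5 (pair (.call 11 (pair (fst (.var 0)) (.op1 .dom (fst (snd (.var 0))))))
    (pair (pair (.op2 .restrict (fst (snd (.var 0))) (snd (snd (.var 0)))) (.const 1)) .nil))

/-- The conditional probability table at a vertex of the decomposition, restricted to the evidence.
The argument consists of the label of the vertex and the context: the data as a relation, and two
tuples of evidence. -/
def tableBody : Expr :=
  .bind (fst (snd (fst (.var 0))))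
    (.bind (.call 12 (pair (fst (snd (.var 1))) (fst (.var 0))))
      (.bind (.call 7 (.call 12 (pair (fst (snd (.var 2))) (snd (.var 1)))))
        (.bind (.call 5 (pair (.call 11 (pair (.var 1) (snd (.var 2)))) (.var 0)))
          (.bind (.call 13 (pair (.var 0) (pair (fst (snd (snd (.var 4)))) (fst (fst (.var 4))))))
            (.call 13 (pair (.var 0) (pair (snd (snd (snd (.var 5)))) (fst (fst (.var 5))))))))))

/-- Multiply a relation with the messages of the subtrees of a forest. The argument consists of the
forest, the relation, its variables and the context. -/
def forestBody : Expr :=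
  .ite (fst (.var 0))
    (.bind (fst (fst (.var 0)))
      (.bind (fst (fst (.var 0)))
        (.bind (.op2 .inter (.var 0) (fst (snd (snd (.var 2)))))
          (.bind (.call 15 (pair (snd (.var 2)) (pair
              (.call 14 (pair (fst (.var 2)) (snd (snd (snd (.var 3))))))
              (pair (.var 1) (snd (snd (snd (.var 3))))))))
            (.bind (.call 12 (pair (.var 0) (.var 1)))
              (.bind (.call 5 (pair (.call 11 (pair (fst (snd (.var 5))) (.var 2))) (.var 0)))
                (.call 15 (pair (snd (fst (.var 6))) (pair (.var 0) (snd (snd (.var 6))))))))))))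
    (fst (snd (.var 0)))

/-- The root relation of a tree. The argument consists of the tree and the context. -/
def collectBody : Expr :=
  .call 15 (pair (snd (fst (.var 0))) (pair (.call 14 (pair (fst (fst (.var 0))) (snd (.var 0))))
    (pair (fst (fst (fst (.var 0)))) (snd (.var 0)))))

/-- Answer a sum-product query. -/
def mainBody : Expr :=
  .bind (.call 8 (fst (.var 0)))
    (.bind (fst (snd (.var 1)))
      (.bind (snd (snd (.var 2)))
        (.bind (fst (snd (.var 0)))
          (.bind (snd (snd (.var 1)))
            (.ite (.var 0)
              (.bind (.call 12 (pair (.call 16 (pair (.var 3) (pair (.var 4) (pair (.var 1)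
                  (.var 0))))) (fst (.var 2))))
                (.call 10 (pair (.var 0) (.call 9 (.call 16 (pair (.var 4) (pair (.var 5)
                  (pair (.var 1) (.var 1)))))))))
              (.call 12 (pair (.call 16 (pair (.var 3) (pair (.var 4) (pair (.var 1)
                  (.var 1))))) (fst (.var 2)))))))))

/-- The position of a body in this list is the number by which `call` refers to it. -/
def prog : Program :=
  [mainBody, splitBody, mergeBody, sortBody, groupBody, joinBody, rekeyBody, recipBody, onesBody,
    totalBody, divideBody, indexBody, marginalBody, filterBody, tableBody, forestBody, collectBody]

/-! ### The basic list functions -/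

variable {n : ℕ} {D : Fin n → Type}

/-- A row of a relation together with a key. -/
abbrev KeyedRow (D : Fin n → Type) : Type := PTuple D × PTuple D × ℝ

/-- The encoding of a list of keyed rows. -/
def encodeKeyed (l : List (KeyedRow D)) : Val D :=
  Val.list (l.map fun e => .cons (.tup e.1) (.cons (.tup e.2.1) (.num e.2.2)))

@[simp] theorem encodeKeyed_nil : encodeKeyed ([] : List (KeyedRow D)) = .nil := rfl

@[simp] theorem encodeKeyed_cons (e : KeyedRow D) (l : List (KeyedRow D)) :
    encodeKeyed (e :: l) =
      .cons (.cons (.tup e.1) (.cons (.tup e.2.1) (.num e.2.2))) (encodeKeyed l) := rfl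

@[simp] theorem encodeRelation_nil : encodeRelation ([] : List (PTuple D × ℝ)) = .nil := rfl

@[simp] theorem encodeRelation_cons (e : PTuple D × ℝ) (l : List (PTuple D × ℝ)) :
    encodeRelation (e :: l) = .cons (.cons (.tup e.1) (.num e.2)) (encodeRelation l) := rfl

/-! ### Sums of the values with a given key -/

open Classical in
/-- The sum of the values of the elements of a list with a given key. -/
def bagOf {α : Type} (key : α → PTuple D) (val : α → ℝ) (l : List α) (k : PTuple D) : ℝ :=
  (l.map fun e => if key e = k then val e else 0).sum

section bagOf

variable {α : Type} {key : α → PTuple D} {val : α → ℝ} {k : PTuple D}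

@[simp] theorem bagOf_nil : bagOf key val [] k = 0 := rfl

theorem bagOf_cons_of_eq {a : α} {l : List α} (h : key a = k) :
    bagOf key val (a :: l) k = val a + bagOf key val l k := by
  simp [bagOf, h]

theorem bagOf_cons_of_ne {a : α} {l : List α} (h : key a ≠ k) :
    bagOf key val (a :: l) k = bagOf key val l k := by
  simp [bagOf, h]

theorem bagOf_eq_zero {l : List α} (h : ∀ a ∈ l, key a ≠ k) : bagOf key val l k = 0 := by
  induction l with
  | nil => rfl
  | cons a l ih =>
    rw [bagOf_cons_of_ne (h a (by simp)), ih fun b hb => h b (List.mem_cons_of_mem _ hb)]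

theorem bagOf_congr {β : Type} {key' : β → PTuple D} {val' : β → ℝ} {l : List α} (f : α → β)
    (hk : ∀ a ∈ l, key' (f a) = key a) (hv : ∀ a ∈ l, val' (f a) = val a) :
    bagOf key' val' (l.map f) k = bagOf key val l k := by
  classical
  rw [bagOf, bagOf, List.map_map]
  congr 1
  refine List.map_congr_left fun a ha => ?_
  simp [hk a ha, hv a ha]

theorem bagOf_perm {l l' : List α} (h : l.Perm l') :
    bagOf key val l k = bagOf key val l' k :=
  (h.map _).sum_eq

end bagOf

/-- The value of a relation at a key: the sum of the values of the rows with this key. -/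
abbrev bag (R : List (PTuple D × ℝ)) : PTuple D → ℝ := bagOf Prod.fst Prod.snd R

theorem bag_cons_of_eq {p k : PTuple D} {a : ℝ} {R : List (PTuple D × ℝ)} (h : p = k) :
    bag ((p, a) :: R) k = a + bag R k :=
  bagOf_cons_of_eq h

theorem bag_cons_of_ne {p k : PTuple D} {a : ℝ} {R : List (PTuple D × ℝ)} (h : p ≠ k) :
    bag ((p, a) :: R) k = bag R k :=
  bagOf_cons_of_ne h

/-! ### Cost and correctness of the list routines -/

variable [∀ i, LinearOrder (D i)]

theorem le_apply_of_le {p p' : PTuple D} (h : toLex p ≤ toLex p') :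
    Op2.apply .le (Val.tup p) (Val.tup p') = some (.num 1) := by
  simp [Op2.apply, h]

theorem le_apply_of_lt {p p' : PTuple D} (h : toLex p' < toLex p) :
    Op2.apply .le (Val.tup p) (Val.tup p') = some .nil := by
  simp [Op2.apply, not_le.2 h]

theorem over_apply {a b : ℝ} (h : b ≠ 0) :
    Op2.apply .over (Val.num a : Val D) (.num b) = some (.num (a / b)) := by
  simp [Op2.apply, h]

/-- Sorted by key. -/
abbrev KeySorted (l : List (KeyedRow D)) : Prop :=
  l.Pairwise fun a b => toLex a.1 ≤ toLex b.1

/-- Strictly sorted. -/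
abbrev RowSorted (l : List (PTuple D × ℝ)) : Prop :=
  l.Pairwise fun a b => toLex a.1 < toLex b.1

/-- The two halves swap roles at each element, which balances them without any counting. Here and
below, the derivation of `Eval` is written out as a term; it determines the step count, which
`omega` then bounds. -/
theorem eval_split (l : List (KeyedRow D)) : ∃ l₁ l₂ c,
    Eval prog [encodeKeyed l] splitBody (.cons (encodeKeyed l₁) (encodeKeyed l₂)) c ∧
    (l₁ ++ l₂).Perm l ∧ l₁.length = (l.length + 1) / 2 ∧ l₂.length = l.length / 2 ∧
    c ≤ 20 * (l.length + 1) := by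
  induction l with
  | nil =>
    refine ⟨[], [], _, .ite_false (.var rfl) (.op2 .nil .nil rfl), by simp, by simp, by simp, ?_⟩
    simp
  | cons e l ih =>
    obtain ⟨l₁, l₂, c, h, hp, h1, h2, hc⟩ := ih
    refine ⟨e :: l₂, l₁, _, .ite_true (.var rfl) nofun
      (.bind (.call (.op1 (.var rfl) rfl) rfl h) (.op2 (.op2 (.op1 (.var rfl) rfl)
        (.op1 (.var rfl) rfl) rfl) (.op1 (.var rfl) rfl) rfl)), ?_, ?_, ?_, ?_⟩
    · exact .cons e ((List.perm_append_comm).trans hp)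
    · simp; omega
    · simp; omega
    · simp; omega

theorem eval_merge (l₁ l₂ : List (KeyedRow D)) (s₁ : KeySorted l₁) (s₂ : KeySorted l₂) :
    ∃ l c, Eval prog [.cons (encodeKeyed l₁) (encodeKeyed l₂)] mergeBody (encodeKeyed l) c ∧
      l.Perm (l₁ ++ l₂) ∧ KeySorted l ∧ c ≤ 50 * (l₁.length + l₂.length + 1) := by
  induction l₁ generalizing l₂ with
  | nil =>
    refine ⟨l₂, _, .ite_false (.op1 (.var rfl) rfl) (.op1 (.var rfl) rfl), by simp, s₂, ?_⟩
    omega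
  | cons e₁ l₁ ih₁ =>
    induction l₂ with
    | nil =>
      refine ⟨e₁ :: l₁, _, .ite_true (.op1 (.var rfl) rfl) nofun
        (.ite_false (.op1 (.var rfl) rfl) (.op1 (.var rfl) rfl)), by simp, s₁, ?_⟩
      omega
    | cons e₂ l₂ ih₂ =>
      rcases le_or_gt (toLex e₁.1) (toLex e₂.1) with h | h
      · obtain ⟨l, c, hl, hp, hs, hc⟩ := ih₁ (e₂ :: l₂) s₁.of_cons s₂
        refine ⟨e₁ :: l, _, .ite_true (.op1 (.var rfl) rfl) nofun
          (.ite_true (.op1 (.var rfl) rfl) nofun (.ite_true (.op2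
            (.op1 (.op1 (.op1 (.var rfl) rfl) rfl) rfl) (.op1 (.op1 (.op1 (.var rfl) rfl) rfl) rfl)
            (le_apply_of_le h)) nofun (.op2 (.op1 (.op1 (.var rfl) rfl) rfl)
              (.call (.op2 (.op1 (.op1 (.var rfl) rfl) rfl) (.op1 (.var rfl) rfl) rfl)
                rfl hl) rfl))), hp.cons e₁, ?_, ?_⟩
        · refine List.pairwise_cons.2 ⟨fun b hb => ?_, hs⟩
          rcases List.mem_append.1 (hp.mem_iff.1 hb) with hb | hb
          · exact List.rel_of_pairwise_cons s₁ hb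
          · rcases List.mem_cons.1 hb with rfl | hb
            · exact h
            · exact h.trans (List.rel_of_pairwise_cons s₂ hb)
        · simp only [List.length_cons] at *; omega
      · obtain ⟨l, c, hl, hp, hs, hc⟩ := ih₂ s₂.of_cons
        refine ⟨e₂ :: l, _, .ite_true (.op1 (.var rfl) rfl) nofun
          (.ite_true (.op1 (.var rfl) rfl) nofun (.ite_false (.op2
            (.op1 (.op1 (.op1 (.var rfl) rfl) rfl) rfl) (.op1 (.op1 (.op1 (.var rfl) rfl) rfl) rfl)
            (le_apply_of_lt h)) (.op2 (.op1 (.op1 (.var rfl) rfl) rfl)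
              (.call (.op2 (.op1 (.var rfl) rfl) (.op1 (.op1 (.var rfl) rfl) rfl) rfl)
                rfl hl) rfl))), ?_, ?_, ?_⟩
        · exact (hp.cons e₂).trans List.perm_middle.symm
        · refine List.pairwise_cons.2 ⟨fun b hb => ?_, hs⟩
          rcases List.mem_append.1 (hp.mem_iff.1 hb) with hb | hb
          · rcases List.mem_cons.1 hb with rfl | hb
            · exact h.le
            · exact h.le.trans (List.rel_of_pairwise_cons s₁ hb)
          · exact List.rel_of_pairwise_cons s₂ hb
        · simp only [List.length_cons] at *; omega

/-- Merge sort with recursion depth `k`. Splitting and merging are linear and are paid by the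
increment `200 * l.length` per level; since the list is not empty, this also absorbs the constants.
-/
theorem eval_sort_aux (k : ℕ) (l : List (KeyedRow D)) (h0 : 1 ≤ l.length) (hk : l.length ≤ 2 ^ k) :
    ∃ l' c, Eval prog [encodeKeyed l] sortBody (encodeKeyed l') c ∧ l'.Perm l ∧ KeySorted l' ∧
      c ≤ 200 * (l.length * (k + 1)) := by
  induction k generalizing l with
  | zero =>
    obtain ⟨e, rfl⟩ := List.length_eq_one_iff.1 (le_antisymm (by simpa using hk) h0)
    exact ⟨[e], _, .ite_true (.var rfl) nofun (.ite_false (.op1 (.var rfl) rfl) (.var rfl)),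
      .rfl, by simp, by simp⟩
  | succ k ih =>
    match l, h0 with
    | [e], _ =>
      exact ⟨[e], _, .ite_true (.var rfl) nofun (.ite_false (.op1 (.var rfl) rfl) (.var rfl)),
        .rfl, by simp, by simp; omega⟩
    | e₁ :: e₂ :: l, _ =>
      obtain ⟨l₁, l₂, c, h, hp, h1, h2, hc⟩ := eval_split (e₁ :: e₂ :: l)
      rw [pow_succ] at hk
      simp only [List.length_cons] at h1 h2 hk hc ⊢
      obtain ⟨l₁', c₁, e1, p1, s1, hc1⟩ := ih l₁ (by omega) (by omega)
      obtain ⟨l₂', c₂, e2, p2, s2, hc2⟩ := ih l₂ (by omega) (by omega)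
      obtain ⟨l', c', e', p', s', hc'⟩ := eval_merge l₁' l₂' s1 s2
      refine ⟨l', _, .ite_true (.var rfl) nofun (.ite_true (.op1 (.var rfl) rfl) nofun
        (.bind (.call (.var rfl) rfl h) (.call (.op2 (.call (.op1 (.var rfl) rfl) rfl e1)
          (.call (.op1 (.var rfl) rfl) rfl e2) rfl) rfl e'))),
        p'.trans ((p1.append p2).trans hp), s', ?_⟩
      have hlen : l₁.length + l₂.length = l.length + 2 := by omega
      have : l₁.length * (k + 1) + l₂.length * (k + 1) = (l.length + 2) * (k + 1) := by
        rw [← add_mul, hlen]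
      have : (l.length + 1 + 1) * (k + 1 + 1) = (l.length + 2) * (k + 1) + (l.length + 2) := by ring
      rw [p1.length_eq, p2.length_eq] at hc'
      omega

theorem eval_sort {t k : ℕ} (ht : t ≤ 2 ^ k) (l : List (KeyedRow D)) (hl : l.length ≤ t) :
    ∃ l' c, Eval prog [encodeKeyed l] sortBody (encodeKeyed l') c ∧ l'.Perm l ∧ KeySorted l' ∧
      c ≤ 200 * ((t + 1) * (k + 1)) := by
  rcases Nat.eq_zero_or_pos l.length with h | h
  · obtain rfl := List.length_eq_zero_iff.1 h
    refine ⟨[], _, .ite_false (.var rfl) .nil, .rfl, by simp, ?_⟩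
    have : 0 < (t + 1) * (k + 1) := by positivity
    omega
  · obtain ⟨l', c, h1, h2, h3, h4⟩ := eval_sort_aux k l h (hl.trans ht)
    refine ⟨l', c, h1, h2, h3, h4.trans ?_⟩
    gcongr
    omega

/-- The tail is grouped first; the head then either joins the first group or opens a new one. That
the keys of `R` come from `l` is part of the induction, as it shows that the head has the smallest
key. -/
theorem eval_group (l : List (KeyedRow D)) (hl : KeySorted l) :
    ∃ R c, Eval prog [encodeKeyed l] groupBody (encodeRelation R) c ∧ RowSorted R ∧
      R.length ≤ l.length ∧ (∀ k, bag R k = bagOf Prod.fst (fun e => e.2.2) l k) ∧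
      (∀ e ∈ R, ∃ e' ∈ l, e'.1 = e.1) ∧ ((∀ e ∈ l, 0 < e.2.2) → ∀ e ∈ R, 0 < e.2) ∧
      c ≤ 60 * (l.length + 1) := by
  induction l with
  | nil =>
    exact ⟨[], _, .ite_false (.var rfl) .nil, by simp, by simp, by simp,
      by simp, by simp, by simp⟩
  | cons e l ih =>
    obtain ⟨R, c, h, hs, hlen, hb, hk, hpos, hc⟩ := ih hl.of_cons
    match R with
    | [] =>
      refine ⟨[(e.1, e.2.2)], _, .ite_true (.var rfl) nofun (.bind (.call (.op1 (.var rfl) rfl)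
        rfl h) (.ite_false (.var rfl) (.op2 (.op2 (.op1 (.op1 (.var rfl) rfl) rfl)
          (.op1 (.op1 (.op1 (.var rfl) rfl) rfl) rfl) rfl) .nil rfl))), by simp, by simp,
          fun k => ?_, by simp, ?_, ?_⟩
      · by_cases hk : e.1 = k
        · rw [bag_cons_of_eq hk, bagOf_cons_of_eq hk, hb]
        · rw [bag_cons_of_ne hk, bagOf_cons_of_ne hk, hb]
      · intro h
        simpa using h e
      · simp; omega
    | f :: R =>
      have hle : ∀ g ∈ f :: R, toLex e.1 ≤ toLex g.1 := fun g hg => by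
        obtain ⟨e', he', h⟩ := hk g hg
        rw [← h]
        exact List.rel_of_pairwise_cons hl he'
      -- The key of `e` is minimal, so this single comparison decides equality of keys.
      rcases le_or_gt (toLex f.1) (toLex e.1) with hfe | hfe
      · have hef : f.1 = e.1 := toLex_inj.1 (le_antisymm hfe (hle f (by simp)))
        refine ⟨(f.1, e.2.2 + f.2) :: R, _, .ite_true (.var rfl) nofun (.bind (.call
          (.op1 (.var rfl) rfl) rfl h) (.ite_true (.var rfl) nofun (.ite_true (.op2
          (.op1 (.op1 (.var rfl) rfl) rfl) (.op1 (.op1 (.var rfl) rfl) rfl) (le_apply_of_le hfe))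
          nofun (.op2 (.op2 (.op1 (.op1 (.var rfl) rfl) rfl) (.op2
            (.op1 (.op1 (.op1 (.var rfl) rfl) rfl) rfl) (.op1 (.op1 (.var rfl) rfl) rfl) rfl) rfl)
            (.op1 (.var rfl) rfl) rfl)))), ?_, ?_, fun k => ?_, ?_, ?_, ?_⟩
        · exact List.pairwise_cons.2 ⟨(List.pairwise_cons.1 hs).1, hs.of_cons⟩
        · simp only [List.length_cons] at *; omega
        · by_cases hk : e.1 = k
          · have hfk := hef.trans hk
            rw [bag_cons_of_eq hfk, bagOf_cons_of_eq hk, ← hb, bag_cons_of_eq hfk, add_assoc]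
          · have hfk := fun h => hk (hef.symm.trans h)
            rw [bag_cons_of_ne hfk, bagOf_cons_of_ne hk, ← hb, bag_cons_of_ne hfk]
        · intro g hg
          rcases List.mem_cons.1 hg with rfl | hg
          · exact ⟨e, by simp, hef.symm⟩
          · obtain ⟨e', he', h⟩ := hk g (List.mem_cons_of_mem _ hg)
            exact ⟨e', List.mem_cons_of_mem _ he', h⟩
        · intro hp g hg
          have hp' := hpos fun e he => hp e (List.mem_cons_of_mem _ he)
          rcases List.mem_cons.1 hg with rfl | hg
          · exact add_pos (hp e (by simp)) (hp' f (by simp))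
          · exact hp' g (List.mem_cons_of_mem _ hg)
        · simp only [List.length_cons] at *; omega
      · refine ⟨(e.1, e.2.2) :: f :: R, _, .ite_true (.var rfl) nofun (.bind (.call
          (.op1 (.var rfl) rfl) rfl h) (.ite_true (.var rfl) nofun (.ite_false (.op2
          (.op1 (.op1 (.var rfl) rfl) rfl) (.op1 (.op1 (.var rfl) rfl) rfl) (le_apply_of_lt hfe))
          (.op2 (.op2 (.op1 (.op1 (.var rfl) rfl) rfl)
          (.op1 (.op1 (.op1 (.var rfl) rfl) rfl) rfl) rfl) (.var rfl) rfl)))),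
          ?_, ?_, fun k => ?_, ?_, ?_, ?_⟩
        · refine List.pairwise_cons.2 ⟨fun g hg => ?_, hs⟩
          rcases List.mem_cons.1 hg with rfl | hg
          · exact hfe
          · exact hfe.trans (List.rel_of_pairwise_cons hs hg)
        · simp only [List.length_cons] at *; omega
        · by_cases hk : e.1 = k
          · rw [bag_cons_of_eq hk, bagOf_cons_of_eq hk, hb]
          · rw [bag_cons_of_ne hk, bagOf_cons_of_ne hk, hb]
        · intro g hg
          rcases List.mem_cons.1 hg with rfl | hg
          · exact ⟨e, by simp, rfl⟩
          · obtain ⟨e', he', h⟩ := hk g hg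
            exact ⟨e', List.mem_cons_of_mem _ he', h⟩
        · intro hp g hg
          rcases List.mem_cons.1 hg with rfl | hg
          · exact hp e (by simp)
          · exact hpos (fun e he => hp e (List.mem_cons_of_mem _ he)) g hg
        · simp only [List.length_cons] at *; omega

/-- A merge join. After a match only `l` advances, since several of its rows may share a key,
whereas the keys of `M` are distinct. Rows without a partner are dropped, in accordance with `bag M`
being zero there. The sublist clause says that no row is created or duplicated. -/
theorem eval_join (l : List (KeyedRow D)) (M : List (PTuple D × ℝ)) (hl : KeySorted l)
    (hM : RowSorted M) :
    ∃ R c, Eval prog [.cons (encodeKeyed l) (encodeRelation M)] joinBody (encodeRelation R) c ∧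
      (R.map Prod.fst).Sublist (l.map fun e => e.2.1) ∧
      (∀ k, bag R k = bagOf (fun e => e.2.1) (fun e => e.2.2 * bag M e.1) l k) ∧
      ((∀ e ∈ l, 0 < e.2.2) → (∀ e ∈ M, 0 < e.2) → ∀ e ∈ R, 0 < e.2) ∧
      c ≤ 80 * (l.length + M.length + 1) := by
  induction l generalizing M with
  | nil =>
    exact ⟨[], _, .ite_false (.op1 (.var rfl) rfl) .nil, by simp, by simp, by simp, by omega⟩
  | cons e l ih =>
    induction M with
    | nil =>
      refine ⟨[], _, .ite_true (.op1 (.var rfl) rfl) nofun (.ite_false (.op1 (.var rfl) rfl) .nil),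
        by simp, fun k => by simp [bagOf], by simp, by omega⟩
    | cons f M ihM =>
      rcases le_or_gt (toLex e.1) (toLex f.1) with hef | hef
      · obtain ⟨R, c, h, hsub, hb, hpos, hc⟩ := ih (f :: M) hl.of_cons hM
        rcases le_or_gt (toLex f.1) (toLex e.1) with hfe | hfe
        · have heq : f.1 = e.1 := toLex_inj.1 (le_antisymm hfe hef)
          refine ⟨(e.2.1, e.2.2 * f.2) :: R, _, .ite_true (.op1 (.var rfl) rfl) nofun
            (.ite_true (.op1 (.var rfl) rfl) nofun (.ite_true (.op2
            (.op1 (.op1 (.op1 (.var rfl) rfl) rfl) rfl) (.op1 (.op1 (.op1 (.var rfl) rfl) rfl) rfl)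
            (le_apply_of_le hef)) nofun (.ite_true (.op2
            (.op1 (.op1 (.op1 (.var rfl) rfl) rfl) rfl) (.op1 (.op1 (.op1 (.var rfl) rfl) rfl) rfl)
            (le_apply_of_le hfe)) nofun (.op2 (.op2
              (.op1 (.op1 (.op1 (.op1 (.var rfl) rfl) rfl) rfl) rfl)
              (.op2 (.op1 (.op1 (.op1 (.op1 (.var rfl) rfl) rfl) rfl) rfl)
                (.op1 (.op1 (.op1 (.var rfl) rfl) rfl) rfl) rfl) rfl)
              (.call (.op2 (.op1 (.op1 (.var rfl) rfl) rfl) (.op1 (.var rfl) rfl) rfl) rfl h)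
              rfl)))), ?_, fun k => ?_, ?_, ?_⟩
          · exact hsub.cons_cons _
          -- The keys in `M` are strictly larger than that of `f`, so `f` is the only match.
          · have hM0 : bag M e.1 = 0 := bagOf_eq_zero fun g hg hge => by
              have := List.rel_of_pairwise_cons hM hg
              rw [hge, heq] at this
              exact this.false
            have h1 : bag (f :: M) e.1 = f.2 := by
              rw [bag_cons_of_eq heq, hM0, add_zero]
            by_cases hk : e.2.1 = k
            · rw [bag_cons_of_eq hk, bagOf_cons_of_eq (key := fun e : KeyedRow D => e.2.1) hk, h1, hb]
            · rw [bag_cons_of_ne hk, bagOf_cons_of_ne (key := fun e : KeyedRow D => e.2.1) hk, hb]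
          · intro hp hq g hg
            rcases List.mem_cons.1 hg with rfl | hg
            · exact mul_pos (hp e (by simp)) (hq f (by simp))
            · exact hpos (fun e he => hp e (List.mem_cons_of_mem _ he)) hq g hg
          · simp only [List.length_cons] at *; omega
        · refine ⟨R, _, .ite_true (.op1 (.var rfl) rfl) nofun
            (.ite_true (.op1 (.var rfl) rfl) nofun (.ite_true (.op2
            (.op1 (.op1 (.op1 (.var rfl) rfl) rfl) rfl) (.op1 (.op1 (.op1 (.var rfl) rfl) rfl) rfl)
            (le_apply_of_le hef)) nofun (.ite_false (.op2
            (.op1 (.op1 (.op1 (.var rfl) rfl) rfl) rfl) (.op1 (.op1 (.op1 (.var rfl) rfl) rfl) rfl)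
            (le_apply_of_lt hfe)) (.call (.op2 (.op1 (.op1 (.var rfl) rfl) rfl)
              (.op1 (.var rfl) rfl) rfl) rfl h)))), hsub.cons _, fun k => ?_, ?_, ?_⟩
          · have hM0 : bag (f :: M) e.1 = 0 := bagOf_eq_zero fun g hg hge => by
              rcases List.mem_cons.1 hg with rfl | hg
              · rw [hge] at hfe
                exact hfe.false
              · have := List.rel_of_pairwise_cons hM hg
                rw [hge] at this
                exact (this.trans hfe).false
            rw [hb k]
            by_cases hk : e.2.1 = k
            · rw [bagOf_cons_of_eq (key := fun e : KeyedRow D => e.2.1) hk, hM0, mul_zero, zero_add]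
            · rw [bagOf_cons_of_ne (key := fun e : KeyedRow D => e.2.1) hk]
          · intro hp hq g hg
            exact hpos (fun e he => hp e (List.mem_cons_of_mem _ he)) hq g hg
          · simp only [List.length_cons] at *; omega
      · obtain ⟨R, c, h, hsub, hb, hpos, hc⟩ := ihM hM.of_cons
        refine ⟨R, _, .ite_true (.op1 (.var rfl) rfl) nofun
            (.ite_true (.op1 (.var rfl) rfl) nofun (.ite_false (.op2
            (.op1 (.op1 (.op1 (.var rfl) rfl) rfl) rfl) (.op1 (.op1 (.op1 (.var rfl) rfl) rfl) rfl)
            (le_apply_of_lt hef)) (.call (.op2 (.op1 (.var rfl) rfl)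
              (.op1 (.op1 (.var rfl) rfl) rfl) rfl) rfl h))), hsub, fun k => ?_, ?_, ?_⟩
        · rw [hb k]
          -- All keys of `e :: l` exceed that of `f`, so discarding `f` changes no value that is
          -- looked up.
          conv_lhs => rw [← List.map_id (e :: l)]
          refine bagOf_congr _ (fun _ _ => rfl) fun g hg => ?_
          have hfg : f.1 ≠ g.1 := by
            intro hfg
            rw [hfg] at hef
            rcases List.mem_cons.1 hg with rfl | hg
            · exact hef.false
            · exact (hef.trans_le (List.rel_of_pairwise_cons hl hg)).false
          change g.2.2 * bag M g.1 = g.2.2 * bag (f :: M) g.1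
          rw [bag_cons_of_ne hfg]
        · intro hp hq g hg
          exact hpos hp (fun e he => hq e (List.mem_cons_of_mem _ he)) g hg
        · simp only [List.length_cons] at *; omega

/-- The rows of a relation, keyed by their projections. -/
def rekey (R : List (PTuple D × ℝ)) (S : Finset (Fin n)) : List (KeyedRow D) :=
  R.map fun e => (e.1.restrict S, e)

theorem eval_rekey (R : List (PTuple D × ℝ)) (S : Finset (Fin n)) :
    ∃ c, Eval prog [.cons (encodeRelation R) (.vars S)] rekeyBody (encodeKeyed (rekey R S)) c ∧
      c ≤ 40 * (R.length + 1) := by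
  induction R with
  | nil => exact ⟨_, .ite_false (.op1 (.var rfl) rfl) .nil, by simp⟩
  | cons e R ih =>
    obtain ⟨c, h, hc⟩ := ih
    refine ⟨_, .ite_true (.op1 (.var rfl) rfl) nofun (.op2 (.op2 (.op2
      (.op1 (.op1 (.op1 (.var rfl) rfl) rfl) rfl) (.op1 (.var rfl) rfl) rfl)
      (.op1 (.op1 (.var rfl) rfl) rfl) rfl) (.call (.op2 (.op1 (.op1 (.var rfl) rfl) rfl)
      (.op1 (.var rfl) rfl) rfl) rfl h) rfl), ?_⟩
    simp only [List.length_cons]; omega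

theorem eval_recip (R : List (PTuple D × ℝ)) (hR : ∀ e ∈ R, 0 < e.2) :
    ∃ c, Eval prog [encodeRelation R] recipBody
        (encodeRelation (R.map fun e => (e.1, (e.2)⁻¹))) c ∧
      c ≤ 30 * (R.length + 1) := by
  induction R with
  | nil => exact ⟨_, .ite_false (.var rfl) .nil, by simp⟩
  | cons e R ih =>
    obtain ⟨c, h, hc⟩ := ih fun e he => hR e (List.mem_cons_of_mem _ he)
    have h1 : Op2.apply .over (Val.num ((1 : ℕ) : ℝ) : Val D) (.num e.2) =
        some (.num (e.2)⁻¹) := by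
      rw [over_apply (hR e (by simp)).ne']
      simp
    refine ⟨_, .ite_true (.var rfl) nofun (.op2 (.op2 (.op1 (.op1 (.var rfl) rfl) rfl)
      (.op2 .const (.op1 (.op1 (.var rfl) rfl) rfl) h1) rfl)
      (.call (.op1 (.var rfl) rfl) rfl h) rfl), ?_⟩
    simp only [List.length_cons]; omega

/-- The data as a relation: every row has the value one. -/
def ones (data : List (Assignment D)) : List (PTuple D × ℝ) := data.map fun d => (d.toPTuple, 1)

theorem eval_ones (data : List (Assignment D)) :
    ∃ c, Eval prog [encodeData data] onesBody (encodeRelation (ones data)) c ∧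
      c ≤ 30 * (data.length + 1) := by
  induction data with
  | nil => exact ⟨_, .ite_false (.var rfl) .nil, by simp⟩
  | cons d data ih =>
    obtain ⟨c, h, hc⟩ := ih
    have h1 : Op2.apply .pair (Val.tup d.toPTuple : Val D) (.num ((1 : ℕ) : ℝ)) =
        some (.cons (.tup d.toPTuple) (.num 1)) := by
      simp [Op2.apply]
    refine ⟨_, .ite_true (.var rfl) nofun (.op2 (.op2 (.op1 (.var rfl) rfl) .const h1)
      (.call (.op1 (.var rfl) rfl) rfl h) rfl), ?_⟩
    simp only [List.length_cons]; omega

theorem eval_total (R : List (PTuple D × ℝ)) :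
    ∃ c, Eval prog [encodeRelation R] totalBody (.num (R.map Prod.snd).sum) c ∧
      c ≤ 30 * (R.length + 1) := by
  induction R with
  | nil =>
    have h1 : Eval prog [encodeRelation ([] : List (PTuple D × ℝ))] (.const 0) (.num 0) 1 := by
      simpa using Eval.const (P := prog) (env := [encodeRelation ([] : List (PTuple D × ℝ))])
        (k := 0)
    exact ⟨_, .ite_false (.var rfl) h1, by simp⟩
  | cons e R ih =>
    obtain ⟨c, h, hc⟩ := ih
    refine ⟨_, .ite_true (.var rfl) nofun (.op2 (.op1 (.op1 (.var rfl) rfl) rfl)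
      (.call (.op1 (.var rfl) rfl) rfl h) rfl), ?_⟩
    simp only [List.length_cons]; omega

/-- The machine cannot divide by zero, but on an empty relation it never divides. This is how a
condition of probability zero is handled. -/
theorem eval_divide (R : List (PTuple D × ℝ)) (b : ℝ) (hb : R ≠ [] → b ≠ 0) :
    ∃ c, Eval prog [.cons (encodeRelation R) (.num b)] divideBody
        (encodeRelation (R.map fun e => (e.1, e.2 / b))) c ∧
      c ≤ 40 * (R.length + 1) := by
  induction R with
  | nil => exact ⟨_, .ite_false (.op1 (.var rfl) rfl) .nil, by simp⟩
  | cons e R ih =>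
    have hb' : b ≠ 0 := hb (by simp)
    obtain ⟨c, h, hc⟩ := ih fun _ => hb'
    refine ⟨_, .ite_true (.op1 (.var rfl) rfl) nofun (.op2 (.op2
      (.op1 (.op1 (.op1 (.var rfl) rfl) rfl) rfl)
      (.op2 (.op1 (.op1 (.op1 (.var rfl) rfl) rfl) rfl) (.op1 (.var rfl) rfl) (over_apply hb'))
      rfl) (.call (.op2 (.op1 (.op1 (.var rfl) rfl) rfl)
      (.op1 (.var rfl) rfl) rfl) rfl h) rfl), ?_⟩
    simp only [List.length_cons]; omega

theorem eval_index {t k : ℕ} (ht : t ≤ 2 ^ k) (R : List (PTuple D × ℝ)) (S : Finset (Fin n))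
    (hR : R.length ≤ t) :
    ∃ l c, Eval prog [.cons (encodeRelation R) (.vars S)] indexBody (encodeKeyed l) c ∧
      l.Perm (rekey R S) ∧ KeySorted l ∧ c ≤ 300 * ((t + 1) * (k + 1)) := by
  obtain ⟨c, h, hc⟩ := eval_rekey R S
  obtain ⟨l, c', h', hp, hs, hc'⟩ := eval_sort ht (rekey R S) (by simpa [rekey] using hR)
  refine ⟨l, _, .call (.call (.var rfl) rfl h) rfl h', hp, hs, ?_⟩
  have : t + 1 ≤ (t + 1) * (k + 1) := Nat.le_mul_of_pos_right _ (by omega)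
  omega

theorem eval_marginal {t k : ℕ} (ht : t ≤ 2 ^ k) (R : List (PTuple D × ℝ)) (S : Finset (Fin n))
    (hR : R.length ≤ t) (hpos : ∀ e ∈ R, 0 < e.2) :
    ∃ M c, Eval prog [.cons (encodeRelation R) (.vars S)] marginalBody (encodeRelation M) c ∧
      RowSorted M ∧ M.length ≤ t ∧
      (∀ x, bag M x = bagOf (fun e => e.1.restrict S) Prod.snd R x) ∧
      (∀ e ∈ M, ∃ e' ∈ R, e'.1.restrict S = e.1) ∧ (∀ e ∈ M, 0 < e.2) ∧
      c ≤ 400 * ((t + 1) * (k + 1)) := by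
  obtain ⟨l, c, h, hp, hs, hc⟩ := eval_index ht R S hR
  obtain ⟨M, c', h', hs', hlen, hb, hk, hpos', hc'⟩ := eval_group l hs
  have hl : l.length = R.length := by rw [hp.length_eq, rekey, List.length_map]
  refine ⟨M, _, .call (.call (.var rfl) rfl h) rfl h', hs', by omega, fun x => ?_, fun e he => ?_,
    hpos' fun e he => ?_, ?_⟩
  · rw [hb, bagOf_perm hp]
    exact bagOf_congr _ (fun _ _ => rfl) fun _ _ => rfl
  · obtain ⟨e', he', h⟩ := hk e he
    obtain ⟨f, hf, rfl⟩ := List.mem_map.1 (hp.mem_iff.1 he')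
    exact ⟨f, hf, h⟩
  · obtain ⟨f, hf, rfl⟩ := List.mem_map.1 (hp.mem_iff.1 he)
    exact hpos f hf
  · have : t + 1 ≤ (t + 1) * (k + 1) := Nat.le_mul_of_pos_right _ (by omega)
    omega

end

end EmpBN

namespace EmpBN

noncomputable section

variable {n : ℕ} {D : Fin n → Type}

/-! ### Projections of tuples -/

theorem PTuple.mem_dom {p : PTuple D} {i : Fin n} : i ∈ p.dom ↔ p i ≠ ⊥ := by
  simp [PTuple.dom]

theorem PTuple.restrict_apply (p : PTuple D) (S : Finset (Fin n)) (i : Fin n) :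
    p.restrict S i = if i ∈ S then p i else ⊥ := rfl

theorem PTuple.dom_restrict (p : PTuple D) (S : Finset (Fin n)) :
    (p.restrict S).dom = S ∩ p.dom := by
  ext i
  simp only [mem_dom, restrict_apply, Finset.mem_inter]
  split_ifs with h <;> simp [h]

theorem PTuple.restrict_restrict (p : PTuple D) {S T : Finset (Fin n)} (h : T ⊆ S) :
    (p.restrict S).restrict T = p.restrict T := by
  funext i
  simp only [restrict_apply]
  split_ifs with h1 h2
  · rfl
  · exact absurd (h h1) h2
  · rfl

theorem PTuple.restrict_inter (p : PTuple D) {S T : Finset (Fin n)} (h : p.dom = S) :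
    p.restrict T = p.restrict (S ∩ T) := by
  subst h
  funext i
  by_cases hi : i ∈ p.dom
  · simp [restrict_apply, hi]
  · have : p i = ⊥ := not_not.1 fun h => hi (mem_dom.2 h)
    simp [restrict_apply, this]

/-- The projection of a full assignment. -/
def Assignment.proj (z : Assignment D) (S : Finset (Fin n)) : PTuple D := z.toPTuple.restrict S

theorem Assignment.proj_apply_of_mem (z : Assignment D) {S : Finset (Fin n)} {i : Fin n}
    (h : i ∈ S) : z.proj S i = (z i : WithBot (D i)) := if_pos h

theorem Assignment.proj_apply_of_notMem (z : Assignment D) {S : Finset (Fin n)} {i : Fin n}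
    (h : i ∉ S) : z.proj S i = ⊥ := if_neg h

theorem Assignment.dom_toPTuple (z : Assignment D) : z.toPTuple.dom = Finset.univ := by
  ext i
  simp [PTuple.mem_dom, Assignment.toPTuple]

theorem Assignment.dom_proj (z : Assignment D) (S : Finset (Fin n)) : (z.proj S).dom = S := by
  rw [proj, PTuple.dom_restrict, dom_toPTuple, Finset.inter_univ]

theorem Assignment.restrict_proj (z : Assignment D) {S T : Finset (Fin n)} (h : T ⊆ S) :
    (z.proj S).restrict T = z.proj T :=
  PTuple.restrict_restrict _ h

theorem PTuple.eq_proj_iff {p : PTuple D} {S : Finset (Fin n)} (hp : p.dom = S)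
    (z : Assignment D) : p = z.proj S ↔ ∀ i ∈ S, p i = (z i : WithBot (D i)) := by
  refine ⟨fun h i hi => by rw [h, z.proj_apply_of_mem hi], fun h => funext fun i => ?_⟩
  by_cases hi : i ∈ S
  · rw [h i hi, z.proj_apply_of_mem hi]
  · rw [z.proj_apply_of_notMem hi]
    rwa [← hp, mem_dom, not_not] at hi

theorem Assignment.proj_eq_proj {z z' : Assignment D} {S : Finset (Fin n)} :
    z.proj S = z'.proj S ↔ ∀ i ∈ S, z i = z' i := by
  rw [PTuple.eq_proj_iff (z.dom_proj S)]
  refine forall₂_congr fun i hi => ?_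
  rw [z.proj_apply_of_mem hi, WithBot.coe_inj]

/-- The assignment `z` fills the gaps of `p`; without it, a domain might be empty. -/
theorem PTuple.exists_extension (p : PTuple D) (z : Assignment D) :
    ∃ z' : Assignment D, p = z'.proj p.dom ∧ ∀ i ∉ p.dom, z' i = z i := by
  refine ⟨fun i => (p i).unbotD (z i), (eq_proj_iff rfl _).2 fun i hi => ?_, fun i hi => ?_⟩
  · obtain ⟨a, ha⟩ := WithBot.ne_bot_iff_exists.1 (mem_dom.1 hi)
    rw [← ha]
    rfl
  · rw [mem_dom, not_not] at hi
    simp [hi]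

theorem PTuple.mem_ext_iff {p : PTuple D} {z : Assignment D} : z ∈ p.ext ↔ p = z.proj p.dom := by
  rw [eq_proj_iff rfl]
  exact forall_congr' fun i => by rw [mem_dom]

/-! ### Summing out variables -/

section marg

variable [∀ i, Fintype (D i)]

open Classical in
/-- Sum out the variables in `A`. -/
def marg (A : Finset (Fin n)) (g : Assignment D → ℝ) (z : Assignment D) : ℝ :=
  ∑ z', if ∀ i ∉ A, z' i = z i then g z' else 0

/-- The function does not depend on the variables outside `S`. -/
def DependsOnly (S : Finset (Fin n)) (g : Assignment D → ℝ) : Prop :=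
  ∀ z z', (∀ i ∈ S, z i = z' i) → g z = g z'

omit [∀ i, Fintype (D i)] in
theorem DependsOnly.mono {S T : Finset (Fin n)} {g : Assignment D → ℝ} (h : DependsOnly S g)
    (hST : S ⊆ T) : DependsOnly T g :=
  fun z z' hz => h z z' fun i hi => hz i (hST hi)

omit [∀ i, Fintype (D i)] in
theorem DependsOnly.prod {ι : Type} {S : Finset (Fin n)} {V : Finset ι}
    {F : ι → Assignment D → ℝ} (h : ∀ v ∈ V, DependsOnly S (F v)) :
    DependsOnly S fun z => ∏ v ∈ V, F v z :=
  fun z z' hz => Finset.prod_congr rfl fun v hv => h v hv z z' hz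

theorem marg_empty (g : Assignment D → ℝ) : marg ∅ g = g := by
  funext z
  have h (z' : Assignment D) : (∀ i ∉ (∅ : Finset (Fin n)), z' i = z i) ↔ z' = z := by
    simp [funext_iff]
  classical
  exact (Finset.sum_congr rfl fun z' _ => if_congr (h z') rfl rfl).trans (by simp)

/-- The distributive law, which allows variables to be summed out locally. -/
theorem marg_mul_left {A S : Finset (Fin n)} {g : Assignment D → ℝ} (hg : DependsOnly S g)
    (h : Disjoint A S) (f : Assignment D → ℝ) :
    marg A (fun z => g z * f z) = fun z => g z * marg A f z := by
  funext z
  rw [marg, marg, Finset.mul_sum]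
  refine Finset.sum_congr rfl fun z' _ => ?_
  split_ifs with hz
  · rw [hg z' z fun i hi => hz i fun hA => Finset.disjoint_left.1 h hA hi]
  · rw [mul_zero]

theorem dependsOnly_marg {A S : Finset (Fin n)} {g : Assignment D → ℝ} (hg : DependsOnly S g) :
    DependsOnly (S \ A) (marg A g) := by
  classical
  intro z w hzw
  -- Replacing the coordinates outside `A` by those of `w`, respectively `z`, gives inverse
  -- bijections between the two ranges of summation.
  let φ (u v : Assignment D) : Assignment D := fun i => if i ∈ A then u i else v i
  simp only [marg]
  rw [← Finset.sum_filter, ← Finset.sum_filter]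
  refine Finset.sum_bij' (fun u _ => φ u w) (fun u _ => φ u z) ?_ ?_ ?_ ?_ ?_
  · intro u _
    simp +contextual [φ]
  · intro u _
    simp +contextual [φ]
  · intro u hu
    rw [Finset.mem_filter] at hu
    funext i
    by_cases hi : i ∈ A
    · simp [φ, hi]
    · simp [φ, hi, hu.2 i hi]
  · intro u hu
    rw [Finset.mem_filter] at hu
    funext i
    by_cases hi : i ∈ A
    · simp [φ, hi]
    · simp [φ, hi, hu.2 i hi]
  · intro u hu
    rw [Finset.mem_filter] at hu
    refine hg _ _ fun i hi => ?_
    by_cases hA : i ∈ A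
    · simp [φ, hA]
    · simp [φ, hA, hu.2 i hA, hzw i (Finset.mem_sdiff.2 ⟨hi, hA⟩)]

theorem marg_marg {A B : Finset (Fin n)} (h : Disjoint A B) (g : Assignment D → ℝ) :
    marg A (marg B g) = marg (A ∪ B) g := by
  classical
  funext z
  simp only [marg]
  simp_rw [← Finset.sum_filter]
  rw [Finset.sum_sigma']
  -- The outer assignment is determined by the inner one: by disjointness they agree on `A`, and
  -- elsewhere the outer one equals `z`.
  refine Finset.sum_bij' (fun x _ => x.2) (fun u _ => ⟨fun i => if i ∈ A then u i else z i, u⟩)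
    ?_ ?_ ?_ ?_ ?_
  · rintro ⟨x, y⟩ hxy
    simp only [Finset.mem_sigma, Finset.mem_filter, Finset.mem_univ, true_and] at hxy ⊢
    intro i hi
    rw [Finset.mem_union, not_or] at hi
    rw [hxy.2 i hi.2, hxy.1 i hi.1]
  · intro u hu
    simp only [Finset.mem_sigma, Finset.mem_filter, Finset.mem_univ, true_and] at hu ⊢
    refine ⟨fun i hi => by simp [hi], fun i hi => ?_⟩
    split_ifs with hA
    · rfl
    · exact hu i (by simp [hA, hi])
  · rintro ⟨x, y⟩ hxy
    simp only [Finset.mem_sigma, Finset.mem_filter, Finset.mem_univ, true_and] at hxy ⊢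
    have : (fun i => if i ∈ A then y i else z i) = x := by
      funext i
      split_ifs with hA
      · exact hxy.2 i (Finset.disjoint_left.1 h hA)
      · exact (hxy.1 i hA).symm
    simp [this]
  · intro u _
    rfl
  · rintro ⟨x, y⟩ _
    rfl

end marg

/-! ### Relations that represent functions -/

/-- The relation `R` lists the non-zero values of the non-negative function `g`, which depends
only on the variables in `S`. -/
structure Represents (S : Finset (Fin n)) (g : Assignment D → ℝ) (R : List (PTuple D × ℝ)) :
    Prop where
  nodup : (R.map Prod.fst).Nodup
  dom : ∀ e ∈ R, e.1.dom = S
  pos : ∀ e ∈ R, 0 < e.2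
  val : ∀ z, g z = bag R (z.proj S)

theorem Represents.dependsOnly {S : Finset (Fin n)} {g : Assignment D → ℝ}
    {R : List (PTuple D × ℝ)} (h : Represents S g R) : DependsOnly S g :=
  fun z z' hz => by rw [h.val, h.val, Assignment.proj_eq_proj.2 hz]

theorem bagOf_mul {α : Type} {key : α → PTuple D} {val val' : α → ℝ} {l : List α} {k : PTuple D}
    {b : ℝ} (h : ∀ a ∈ l, key a = k → val a = val' a * b) :
    bagOf key val l k = bagOf key val' l k * b := by
  induction l with
  | nil => simp
  | cons a l ih =>
    have ih' := ih fun a ha => h a (List.mem_cons_of_mem _ ha)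
    by_cases hk : key a = k
    · rw [bagOf_cons_of_eq hk, bagOf_cons_of_eq hk, ih', h a (by simp) hk, add_mul]
    · rw [bagOf_cons_of_ne hk, bagOf_cons_of_ne hk, ih']

/-- Both sides are additive in the rows, so it is enough to compare the contributions of a single
row. -/
theorem bagOf_restrict_eq_marg [∀ i, Fintype (D i)] {S T : Finset (Fin n)} (hT : T ⊆ S)
    {R : List (PTuple D × ℝ)} (hR : ∀ e ∈ R, e.1.dom = S) (z : Assignment D) :
    bagOf (fun e => e.1.restrict T) Prod.snd R (z.proj T) =
      marg (S \ T) (fun z => bag R (z.proj S)) z := by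
  classical
  induction R with
  | nil => simp [marg]
  | cons e R ih =>
    have hdom : e.1.dom = S := hR e (by simp)
    have key : marg (S \ T) (fun z => if e.1 = z.proj S then e.2 else 0) z =
        if e.1.restrict T = z.proj T then e.2 else 0 := by
      -- The row `e` on `S`, completed by `z`, is the only assignment that can contribute to the
      -- sum.
      obtain ⟨u, hu, huz⟩ := e.1.exists_extension z
      rw [hdom] at hu huz
      rw [marg, hu, Assignment.restrict_proj _ hT]
      rw [Finset.sum_eq_single u]
      · rw [if_pos rfl]
        refine if_congr ?_ rfl rfl
        rw [Assignment.proj_eq_proj]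
        refine ⟨fun h i hi => h i fun h' => (Finset.mem_sdiff.1 h').2 hi, fun h i hi => ?_⟩
        by_cases hS : i ∈ S
        · exact h i (by_contra fun hT => hi (Finset.mem_sdiff.2 ⟨hS, hT⟩))
        · exact huz i hS
      · intro v _ hvu
        by_cases hv : ∀ i ∉ S \ T, v i = z i
        · rw [if_pos hv, if_neg]
          intro h
          refine hvu (funext fun i => ?_)
          by_cases hS : i ∈ S
          · exact (Assignment.proj_eq_proj.1 h i hS).symm
          · rw [huz i hS, hv i fun h => hS (Finset.mem_sdiff.1 h).1]
        · rw [if_neg hv]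
      · simp
    have hcons : ∀ z : Assignment D, bag (e :: R) (z.proj S) =
        (if e.1 = z.proj S then e.2 else 0) + bag R (z.proj S) := fun z => by
      split_ifs with h
      · exact bag_cons_of_eq h
      · rw [zero_add]
        exact bag_cons_of_ne h
    have hadd : marg (S \ T) (fun z => bag (e :: R) (z.proj S)) z =
        marg (S \ T) (fun z => if e.1 = z.proj S then e.2 else 0) z +
          marg (S \ T) (fun z => bag R (z.proj S)) z := by
      simp only [marg, hcons, ← Finset.sum_add_distrib]
      exact Finset.sum_congr rfl fun z' _ => by split_ifs <;> simp
    rw [hadd, key, ← ih fun e he => hR e (List.mem_cons_of_mem _ he)]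
    split_ifs with h
    · rw [bagOf_cons_of_eq (key := fun e : PTuple D × ℝ => e.1.restrict T) h]
    · rw [bagOf_cons_of_ne (key := fun e : PTuple D × ℝ => e.1.restrict T) h, zero_add]

variable [∀ i, LinearOrder (D i)]

theorem RowSorted.nodup {R : List (PTuple D × ℝ)} (h : RowSorted R) :
    (R.map Prod.fst).Nodup :=
  List.pairwise_map.2 (h.imp fun {a b} hab he => by rw [he] at hab; exact hab.false)

theorem Represents.eval_marginal [∀ i, Fintype (D i)] {t k : ℕ} (ht : t ≤ 2 ^ k)
    {S T : Finset (Fin n)} {g : Assignment D → ℝ} {R : List (PTuple D × ℝ)}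
    (h : Represents S g R) (hT : T ⊆ S) (hR : R.length ≤ t) :
    ∃ M c, Eval prog [.cons (encodeRelation R) (.vars T)] marginalBody (encodeRelation M) c ∧
      RowSorted M ∧ M.length ≤ t ∧ Represents T (marg (S \ T) g) M ∧
      c ≤ 400 * ((t + 1) * (k + 1)) := by
  obtain ⟨M, c, hM, hs, hlen, hb, hk, hpos, hc⟩ := EmpBN.eval_marginal ht R T hR h.pos
  refine ⟨M, c, hM, hs, hlen, ⟨hs.nodup, fun e he => ?_, hpos, fun z => ?_⟩, hc⟩
  · obtain ⟨e', he', h'⟩ := hk e he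
    rw [← h', PTuple.dom_restrict, h.dom e' he', Finset.inter_eq_left.2 hT]
  · rw [hb, bagOf_restrict_eq_marg hT h.dom, funext h.val]

/-- The factor `f` depends only on variables in `S`, so the product lives on the rows of `R` and the
size bound `t` survives. The bound `t + 1` for `M` admits the one-row relation of an indicator even
if `t = 0`. -/
theorem Represents.eval_join {t k : ℕ} (ht : t ≤ 2 ^ k) {S T : Finset (Fin n)}
    {g f : Assignment D → ℝ} {R M : List (PTuple D × ℝ)} (h : Represents S g R)
    (hf : Represents (S ∩ T) f M) (hs : RowSorted M) (hR : R.length ≤ t) (hM : M.length ≤ t + 1) :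
    ∃ l c₁ R' c₂, Eval prog [.cons (encodeRelation R) (.vars T)] indexBody (encodeKeyed l) c₁ ∧
      Eval prog [.cons (encodeKeyed l) (encodeRelation M)] joinBody (encodeRelation R') c₂ ∧
      Represents S (fun z => g z * f z) R' ∧ R'.length ≤ t ∧
      c₁ ≤ 300 * ((t + 1) * (k + 1)) ∧ c₂ ≤ 200 * ((t + 1) * (k + 1)) := by
  obtain ⟨l, c₁, h1, hp, hl, hc1⟩ := eval_index ht R T hR
  obtain ⟨R', c₂, h2, hsub, hb, hpos, hc2⟩ := EmpBN.eval_join l M hl hs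
  have hkeys : (l.map fun e => e.2.1).Perm (R.map Prod.fst) := by
    refine (hp.map _).trans ?_
    rw [rekey, List.map_map]
    exact List.Perm.refl _
  refine ⟨l, c₁, R', c₂, h1, h2, ⟨hsub.nodup (hkeys.nodup_iff.2 h.nodup), fun e he => ?_,
    hpos (fun e he => ?_) hf.pos, fun z => ?_⟩, ?_, hc1, ?_⟩
  · obtain ⟨e', he', h'⟩ := List.mem_map.1 (hkeys.mem_iff.1 (hsub.subset (List.mem_map_of_mem he)))
    rw [← h', h.dom e' he']
  · obtain ⟨e', he', rfl⟩ := List.mem_map.1 (hp.mem_iff.1 he)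
    exact h.pos e' he'
  · have h3 : bagOf (fun e => e.2.1) (fun e => e.2.2 * bag M e.1) (rekey R T) (z.proj S) =
        bagOf Prod.fst (fun e => e.2 * bag M (e.1.restrict T)) R (z.proj S) :=
      bagOf_congr _ (fun _ _ => rfl) fun _ _ => rfl
    rw [hb, bagOf_perm hp, h3, h.val, hf.val]
    refine (bagOf_mul fun e he hk => ?_).symm
    -- On a row over `S`, projecting to `T` is the same as projecting to `S ∩ T`, the variables of
    -- `M`.
    rw [e.1.restrict_inter (h.dom e he), hk, Assignment.restrict_proj _ Finset.inter_subset_left]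
  · have := hsub.length_le
    rw [hkeys.length_eq] at this
    simpa using this.trans (by simpa using hR)
  · have : t + 1 ≤ (t + 1) * (k + 1) := Nat.le_mul_of_pos_right _ (by omega)
    have := hp.length_eq
    rw [rekey, List.length_map] at this
    omega

theorem bag_map_inv {R : List (PTuple D × ℝ)} (h : (R.map Prod.fst).Nodup) (k : PTuple D) :
    bag (R.map fun e => (e.1, (e.2)⁻¹)) k = (bag R k)⁻¹ := by
  induction R with
  | nil => simp
  | cons e R ih =>
    rw [List.map_cons, List.nodup_cons] at h
    rw [List.map_cons]
    by_cases hk : e.1 = k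
    · have h0 : ∀ R' : List (PTuple D × ℝ), R'.map Prod.fst = R.map Prod.fst → bag R' k = 0 :=
        fun R' hR' => bagOf_eq_zero fun f hf hfk => h.1 (by
          rw [hk, ← hfk, ← hR']
          exact List.mem_map_of_mem hf)
      rw [bag_cons_of_eq hk, bag_cons_of_eq hk, h0 R rfl, h0 _ (by simp)]
      simp
    · rw [bag_cons_of_ne hk, bag_cons_of_ne hk, ih h.2]

/-- Because `0⁻¹ = 0`, absent rows stay absent. This matches the value zero of a table at parent
configurations that do not occur in the data. -/
theorem Represents.inv {S : Finset (Fin n)} {g : Assignment D → ℝ} {R : List (PTuple D × ℝ)}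
    (h : Represents S g R) :
    Represents S (fun z => (g z)⁻¹) (R.map fun e => (e.1, (e.2)⁻¹)) where
  nodup := by
    rw [List.map_map]
    exact h.nodup
  dom e he := by
    obtain ⟨f, hf, rfl⟩ := List.mem_map.1 he
    exact h.dom f hf
  pos e he := by
    obtain ⟨f, hf, rfl⟩ := List.mem_map.1 he
    exact inv_pos.2 (h.pos f hf)
  val z := by rw [bag_map_inv h.nodup, h.val]

/-! ### The tables of the empirical Bayesian network -/

open Classical in
/-- The indicator function of consistency with a tuple on the variables in `S`. -/
def consistent (p : PTuple D) (S : Finset (Fin n)) (z : Assignment D) : ℝ :=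
  if p.restrict S = z.proj (S ∩ p.dom) then 1 else 0

theorem represents_consistent (p : PTuple D) (S : Finset (Fin n)) :
    Represents (S ∩ p.dom) (consistent p S) [(p.restrict S, 1)] where
  nodup := by simp
  dom e he := by
    rw [List.mem_singleton.1 he]
    exact p.dom_restrict S
  pos e he := by
    rw [List.mem_singleton.1 he]
    exact one_pos
  val z := by
    rw [consistent]
    split_ifs with h
    · rw [bag_cons_of_eq h, bag, bagOf_nil, add_zero]
    · rw [bag_cons_of_ne h, bag, bagOf_nil]

/-- Selection is a join with the one-row relation of the indicator function. -/
theorem Represents.eval_filter {t k : ℕ} (ht : t ≤ 2 ^ k) {S : Finset (Fin n)}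
    {g : Assignment D → ℝ} {R : List (PTuple D × ℝ)} (h : Represents S g R) (p : PTuple D)
    (hR : R.length ≤ t) :
    ∃ R' c, Eval prog [.cons (encodeRelation R) (.cons (.tup p) (.vars S))] filterBody
        (encodeRelation R') c ∧
      Represents S (fun z => g z * consistent p S z) R' ∧ R'.length ≤ t ∧
      c ≤ 600 * ((t + 1) * (k + 1)) := by
  obtain ⟨l, c₁, R', c₂, h1, h2, h3, h4, hc1, hc2⟩ := h.eval_join ht
    (represents_consistent p S) (by simp) hR (by simp)
  have hone : Op2.apply .pair (Val.tup (p.restrict S) : Val D) (.num ((1 : ℕ) : ℝ)) =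
      some (.cons (.tup (p.restrict S)) (.num 1)) := by
    simp [Op2.apply]
  refine ⟨R', _, .call (.op2 (.call (.op2 (.op1 (.var rfl) rfl) (.op1 (.op1 (.op1 (.var rfl) rfl)
    rfl) rfl) rfl) rfl h1) (.op2 (.op2 (.op2 (.op1 (.op1 (.var rfl) rfl) rfl)
      (.op1 (.op1 (.var rfl) rfl) rfl) rfl) .const hone) .nil rfl) rfl) rfl h2, h3, h4, ?_⟩
  have : 0 < (t + 1) * (k + 1) := by positivity
  omega

theorem count_eq_bagOf (data : List (Assignment D)) (S : Finset (Fin n)) (z : Assignment D) :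
    (count data S z : ℝ) = bagOf (fun e => e.1.restrict S) Prod.snd (ones data) (z.proj S) := by
  classical
  induction data with
  | nil => simp [count, ones]
  | cons d data ih =>
    have hiff : d.toPTuple.restrict S = z.proj S ↔ ∀ i ∈ S, d i = z i :=
      Assignment.proj_eq_proj (z := d)
    have hones : ones (d :: data) = (d.toPTuple, 1) :: ones data := rfl
    rw [hones]
    by_cases h : ∀ i ∈ S, d i = z i
    · rw [bagOf_cons_of_eq (key := fun e : PTuple D × ℝ => e.1.restrict S) (hiff.2 h), ← ih, count,
        List.countP_cons_of_pos (by simpa using h), add_comm]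
      simp [count]
    · rw [bagOf_cons_of_ne (key := fun e : PTuple D × ℝ => e.1.restrict S) fun h' => h (hiff.1 h'),
        ← ih, count, List.countP_cons_of_neg (by simpa using h)]
      simp [count]

theorem eval_count {t k : ℕ} (ht : t ≤ 2 ^ k) (data : List (Assignment D))
    (hdata : data.length ≤ t) (S : Finset (Fin n)) :
    ∃ M c, Eval prog [.cons (encodeRelation (ones data)) (.vars S)] marginalBody
        (encodeRelation M) c ∧
      RowSorted M ∧ M.length ≤ t ∧ Represents S (fun z => (count data S z : ℝ)) M ∧
      c ≤ 400 * ((t + 1) * (k + 1)) := by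
  obtain ⟨M, c, hM, hs, hlen, hb, hk, hpos, hc⟩ := eval_marginal ht (ones data) S
    (by simpa [ones] using hdata) (by simp [ones])
  refine ⟨M, c, hM, hs, hlen, ⟨hs.nodup, fun e he => ?_, hpos, fun z => ?_⟩, hc⟩
  · obtain ⟨e', he', h'⟩ := hk e he
    obtain ⟨d, -, rfl⟩ := List.mem_map.1 he'
    rw [← h']
    exact d.dom_proj S
  · rw [hb, count_eq_bagOf]

/-- The function of the variable `i` and its parents, restricted to the evidence. -/
def evidenceTable (G : Digraph (Fin n)) (data : List (Assignment D)) (p q : PTuple D) (i : Fin n)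
    (z : Assignment D) : ℝ :=
  (empBN G data).f i z * consistent p (family G i) z * consistent q (family G i) z

/-- The context of the evaluation: the data and the evidence. -/
def context (data : List (Assignment D)) (p q : PTuple D) : Val D :=
  .cons (encodeRelation (ones data)) (.cons (.tup p) (.tup q))

/-- The label of a vertex of width one. -/
def label (G : Digraph (Fin n)) (i : Fin n) : Val D :=
  .cons (.vars (family G i)) (.cons (.cons (.vars (family G i)) (.vars (parents G i))) .nil)

/-- The counts over the family are joined with the reciprocals of the counts over the parents. Event
and condition are filtered separately, since they may conflict and no machine operation merges two
tuples. -/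
theorem eval_table {t k : ℕ} (ht : t ≤ 2 ^ k) (G : Digraph (Fin n)) (data : List (Assignment D))
    (hdata : data.length ≤ t) (p q : PTuple D) (i : Fin n) :
    ∃ R c, Eval prog [.cons (label G i) (context data p q)] tableBody (encodeRelation R) c ∧
      Represents (family G i) (evidenceTable G data p q i) R ∧ R.length ≤ t ∧
      c ≤ 3000 * ((t + 1) * (k + 1)) := by
  obtain ⟨A, c₁, e1, s1, l1, r1, hc1⟩ := eval_count ht data hdata (family G i)
  obtain ⟨B, c₂, e2, s2, l2, r2, hc2⟩ := eval_count ht data hdata (parents G i)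
  obtain ⟨c₃, e3, hc3⟩ := eval_recip B r2.pos
  have hsub : family G i ∩ parents G i = parents G i :=
    Finset.inter_eq_right.2 (Finset.subset_insert _ _)
  have s3 : RowSorted (B.map fun e => (e.1, (e.2)⁻¹)) := List.pairwise_map.2 s2
  obtain ⟨l, c₄, J, c₅, e4, e5, r5, l5, hc4, hc5⟩ := r1.eval_join ht (T := parents G i)
    (by rw [hsub]; exact r2.inv) s3 l1 (by simp; omega)
  obtain ⟨J₁, c₆, e6, r6, l6, hc6⟩ := r5.eval_filter ht p l5
  obtain ⟨J₂, c₇, e7, r7, l7, hc7⟩ := r6.eval_filter ht q l6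
  refine ⟨J₂, _, .bind (.op1 (.op1 (.op1 (.var rfl) rfl) rfl) rfl)
    (.bind (.call (.op2 (.op1 (.op1 (.var rfl) rfl) rfl) (.op1 (.var rfl) rfl) rfl) rfl e1)
    (.bind (.call (.call (.op2 (.op1 (.op1 (.var rfl) rfl) rfl) (.op1 (.var rfl) rfl) rfl) rfl e2)
      rfl e3)
    (.bind (.call (.op2 (.call (.op2 (.var rfl) (.op1 (.var rfl) rfl) rfl) rfl e4) (.var rfl) rfl)
      rfl e5)
    (.bind (.call (.op2 (.var rfl) (.op2 (.op1 (.op1 (.op1 (.var rfl) rfl) rfl) rfl)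
      (.op1 (.op1 (.var rfl) rfl) rfl) rfl) rfl) rfl e6)
    (.call (.op2 (.var rfl) (.op2 (.op1 (.op1 (.op1 (.var rfl) rfl) rfl) rfl)
      (.op1 (.op1 (.var rfl) rfl) rfl) rfl) rfl) rfl e7))))), ?_, l7, ?_⟩
  · simpa only [div_eq_mul_inv] using! r7
  · have : t + 1 ≤ (t + 1) * (k + 1) := Nat.le_mul_of_pos_right _ (by omega)
    omega

end

end EmpBN

namespace EmpBN

noncomputable section

variable {n : ℕ} {D : Fin n → Type}

/-! ### Message passing -/

/-- The variables of a set of vertices. -/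
def scopeOf {ι : Type} (G : Digraph (Fin n)) (φ : ι → Fin n) (V : Finset ι) : Finset (Fin n) :=
  V.biUnion fun v => family G (φ v)

theorem scopeOf_insert {ι : Type} [DecidableEq ι] (G : Digraph (Fin n)) (φ : ι → Fin n) (c : ι)
    (V : Finset ι) : scopeOf G φ (insert c V) = family G (φ c) ∪ scopeOf G φ V :=
  Finset.biUnion_insert

theorem scopeOf_union {ι : Type} [DecidableEq ι] (G : Digraph (Fin n)) (φ : ι → Fin n)
    (V W : Finset ι) : scopeOf G φ (V ∪ W) = scopeOf G φ V ∪ scopeOf G φ W :=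
  Finset.union_biUnion

/-- The value encodes a forest with the vertices `V`, below a vertex with variables `S`. The
vertices are distinct, and the variables that two parts of the tree have in common occur in the
vertex between them. -/
inductive JoinForest {ι : Type} [DecidableEq ι] (G : Digraph (Fin n)) (φ : ι → Fin n) :
    Finset (Fin n) → Val D → Finset ι → Prop
  | nil {S} : JoinForest G φ S .nil ∅
  | cons {S c x y V W} : JoinForest G φ (family G (φ c)) x V → JoinForest G φ S y W → c ∉ V →
      Disjoint (insert c V) W → scopeOf G φ V ∩ S ⊆ family G (φ c) →
      scopeOf G φ (insert c V) ∩ scopeOf G φ W ⊆ S →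
      JoinForest G φ S (.cons (.cons (label G (φ c)) x) y) (insert c V ∪ W)

/-- Here `A` is the family of a vertex, `U` the variables below it and `S` the family of its parent.
Since `U` meets `S` only inside `A`, summing out first `U \ A` and then `A \ S` removes exactly the
variables outside `S`. -/
theorem marg_message [∀ i, Fintype (D i)] {A S U : Finset (Fin n)} {f g : Assignment D → ℝ}
    (hf : DependsOnly A f) (h : U ∩ S ⊆ A) :
    marg (A \ (A ∩ S)) (fun z => f z * marg (U \ A) g z) =
      marg ((A ∪ U) \ S) (fun z => f z * g z) := by
  rw [← marg_mul_left hf Finset.sdiff_disjoint, marg_marg]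
  · congr 1
    ext i
    have := @h i
    simp only [Finset.mem_inter, Finset.mem_union, Finset.mem_sdiff] at *
    tauto
  · rw [Finset.disjoint_left]
    intro i h1 h2
    exact (Finset.mem_sdiff.1 h2).2 (Finset.mem_sdiff.1 h1).1

/-- Different subtrees share variables only through the separator `S`, so their sums factorize. -/
theorem marg_mul_marg [∀ i, Fintype (D i)] {S U W : Finset (Fin n)} {f g : Assignment D → ℝ}
    (hf : DependsOnly U f) (hg : DependsOnly W g) (h : U ∩ W ⊆ S) :
    marg ((U ∪ W) \ S) (fun z => f z * g z) = fun z => marg (U \ S) f z * marg (W \ S) g z := by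
  have hd : Disjoint (U \ S) W := Finset.disjoint_left.2 fun i h1 h2 =>
    (Finset.mem_sdiff.1 h1).2 (h (Finset.mem_inter.2 ⟨(Finset.mem_sdiff.1 h1).1, h2⟩))
  have hd' : Disjoint (W \ S) U := Finset.disjoint_left.2 fun i h1 h2 =>
    (Finset.mem_sdiff.1 h1).2 (h (Finset.mem_inter.2 ⟨h2, (Finset.mem_sdiff.1 h1).1⟩))
  rw [Finset.union_sdiff_distrib, ← marg_marg (hd.mono_right Finset.sdiff_subset),
    marg_mul_left hf hd']
  simp_rw [mul_comm (f _)]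
  rw [marg_mul_left ((dependsOnly_marg hg).mono Finset.sdiff_subset) hd]
  funext z
  rw [mul_comm]

variable [∀ i, LinearOrder (D i)]

theorem dependsOnly_evidenceTable (G : Digraph (Fin n)) (data : List (Assignment D))
    (p q : PTuple D) (i : Fin n) : DependsOnly (family G i) (evidenceTable G data p q i) := by
  -- The dependence is read off from the relation that the program computes; any admissible `k`
  -- serves.
  obtain ⟨R, -, -, h, -⟩ := eval_table (k := data.length) Nat.lt_two_pow_self.le G data le_rfl p q i
  exact h.dependsOnly

theorem dependsOnly_prod_evidenceTable {ι : Type} (G : Digraph (Fin n))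
    (data : List (Assignment D)) (p q : PTuple D) (φ : ι → Fin n) (V : Finset ι) :
    DependsOnly (scopeOf G φ V) fun z => ∏ v ∈ V, evidenceTable G data p q (φ v) z :=
  DependsOnly.prod fun v hv => (dependsOnly_evidenceTable G data p q (φ v)).mono
    (Finset.subset_biUnion_of_mem (fun v => family G (φ v)) hv)

variable [∀ i, Fintype (D i)]

/-- The accumulator `R`, a relation over the parent's family `S`, absorbs one message per subtree.
It is arbitrary in the induction, since each remaining forest starts from an updated one. -/
theorem JoinForest.eval {ι : Type} [DecidableEq ι] {G : Digraph (Fin n)} {φ : ι → Fin n}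
    {S : Finset (Fin n)} {x : Val D} {V : Finset ι} (h : JoinForest G φ S x V)
    {t k : ℕ} (ht : t ≤ 2 ^ k) (data : List (Assignment D)) (hdata : data.length ≤ t)
    (p q : PTuple D) {g : Assignment D → ℝ} {R : List (PTuple D × ℝ)} (hR : Represents S g R)
    (hlen : R.length ≤ t) :
    ∃ R' c, Eval prog [.cons x (.cons (encodeRelation R) (.cons (.vars S) (context data p q)))]
        forestBody (encodeRelation R') c ∧
      Represents S (fun z => g z * marg (scopeOf G φ V \ S)
        (fun z => ∏ v ∈ V, evidenceTable G data p q (φ v) z) z) R' ∧ R'.length ≤ t ∧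
      c ≤ (5000 * V.card + 10) * ((t + 1) * (k + 1)) := by
  induction h generalizing g R with
  | @nil S =>
    refine ⟨R, _, .ite_false (.op1 (.var rfl) rfl) (.op1 (.op1 (.var rfl) rfl) rfl), ?_, hlen, ?_⟩
    · simpa [scopeOf, marg_empty] using hR
    · have : 0 < (t + 1) * (k + 1) := by positivity
      simp only [Finset.card_empty]
      omega
  | @cons S c x y V W h1 h2 hc hdisj hS hsep ih1 ih2 =>
    obtain ⟨R₀, c₀, e0, r0, l0, hc0⟩ := eval_table ht G data hdata p q (φ c)
    obtain ⟨R₁, c₁, e1, r1, l1, hc1⟩ := ih1 r0 l0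
    obtain ⟨M, c₂, e2, s2, l2, r2, hc2⟩ := r1.eval_marginal ht
      (T := family G (φ c) ∩ S) Finset.inter_subset_left l1
    have hT : S ∩ (family G (φ c) ∩ S) = family G (φ c) ∩ S :=
      Finset.inter_eq_right.2 Finset.inter_subset_right
    obtain ⟨l, c₃, R₂, c₄, e3, e4, r4, l4, hc3, hc4⟩ := hR.eval_join ht
      (T := family G (φ c) ∩ S) (by rw [hT]; exact r2) s2 hlen (by omega)
    obtain ⟨R₃, c₅, e5, r5, l5, hc5⟩ := ih2 r4 l4
    refine ⟨R₃, _, .ite_true (.op1 (.var rfl) rfl) nofun (.bind (.op1 (.op1 (.var rfl) rfl) rfl)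
      (.bind (.op1 (.op1 (.var rfl) rfl) rfl) (.bind (.op2 (.var rfl)
        (.op1 (.op1 (.op1 (.var rfl) rfl) rfl) rfl) rfl)
      (.bind (.call (.op2 (.op1 (.var rfl) rfl) (.op2 (.call (.op2 (.op1 (.var rfl) rfl)
        (.op1 (.op1 (.op1 (.var rfl) rfl) rfl) rfl) rfl) rfl e0)
        (.op2 (.var rfl) (.op1 (.op1 (.op1 (.var rfl) rfl) rfl) rfl) rfl) rfl) rfl) rfl e1)
      (.bind (.call (.op2 (.var rfl) (.var rfl) rfl) rfl e2)
      (.bind (.call (.op2 (.call (.op2 (.op1 (.op1 (.var rfl) rfl) rfl) (.var rfl) rfl) rfl e3)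
        (.var rfl) rfl) rfl e4)
      (.call (.op2 (.op1 (.op1 (.var rfl) rfl) rfl) (.op2 (.var rfl)
        (.op1 (.op1 (.var rfl) rfl) rfl) rfl) rfl) rfl e5))))))), ?_, l5, ?_⟩
    · convert r5 using 2 with z
      rw [mul_assoc, marg_message (dependsOnly_evidenceTable G data p q (φ c)) hS,
        scopeOf_union, ← scopeOf_insert]
      have hdep := dependsOnly_prod_evidenceTable G data p q φ (insert c V)
      simp only [Finset.prod_insert hc] at hdep
      simp only [Finset.prod_union hdisj, Finset.prod_insert hc]
      rw [marg_mul_marg hdep (dependsOnly_prod_evidenceTable G data p q φ _) hsep]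
    · rw [Finset.card_union_of_disjoint hdisj, Finset.card_insert_of_notMem hc]
      have h0 : 0 < (t + 1) * (k + 1) := by positivity
      generalize (t + 1) * (k + 1) = B at *
      -- After the two recursive calls, `4990 * B` is left for the vertex `c`: 3000 for its table,
      -- 400 for the message, 500 for the join, and the overhead.
      have : (5000 * (V.card + 1 + W.card) + 10) * B =
        (5000 * V.card + 10) * B + (5000 * W.card + 10) * B + 4990 * B := by ring
      omega

/-- The value encodes a tree whose vertices correspond to the variables; the variables that two
parts of the tree have in common occur in the vertex between them. -/
def IsJoinTree {ι : Type} [Fintype ι] [DecidableEq ι] (G : Digraph (Fin n)) (φ : ι → Fin n) (r : ι)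
    (x : Val D) : Prop :=
  Function.Bijective φ ∧ ∃ y V, x = .cons (label G (φ r)) y ∧
    JoinForest G φ (family G (φ r)) y V ∧ r ∉ V ∧ insert r V = Finset.univ

/-- The product of all functions of the network, restricted to the evidence. -/
def evidenceProd (G : Digraph (Fin n)) (data : List (Assignment D)) (p q : PTuple D)
    (z : Assignment D) : ℝ :=
  ∏ i, evidenceTable G data p q i z

theorem IsJoinTree.eval {ι : Type} [Fintype ι] [DecidableEq ι] {G : Digraph (Fin n)}
    {φ : ι → Fin n} {r : ι} {x : Val D} (h : IsJoinTree G φ r x)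
    {t k : ℕ} (ht : t ≤ 2 ^ k) (data : List (Assignment D)) (hdata : data.length ≤ t)
    (p q : PTuple D) :
    ∃ R c, Eval prog [.cons x (context data p q)] collectBody (encodeRelation R) c ∧
      Represents (family G (φ r)) (marg (Finset.univ \ family G (φ r))
        (evidenceProd G data p q)) R ∧ R.length ≤ t ∧
      c ≤ 9000 * (n * ((t + 1) * (k + 1))) := by
  obtain ⟨hφ, y, V, rfl, hV, hr, huniv⟩ := h
  obtain ⟨R₀, c₀, e0, r0, l0, hc0⟩ := eval_table ht G data hdata p q (φ r)
  obtain ⟨R₁, c₁, e1, r1, l1, hc1⟩ := hV.eval ht data hdata p q r0 l0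
  refine ⟨R₁, _, .call (.op2 (.op1 (.op1 (.var rfl) rfl) rfl) (.op2 (.call (.op2
    (.op1 (.op1 (.var rfl) rfl) rfl) (.op1 (.var rfl) rfl) rfl) rfl e0)
    (.op2 (.op1 (.op1 (.op1 (.var rfl) rfl) rfl) rfl) (.op1 (.var rfl) rfl) rfl) rfl) rfl) rfl e1,
    ?_, l1, ?_⟩
  -- Each variable occurs in the family of its own vertex.
  · have hscope : family G (φ r) ∪ scopeOf G φ V = Finset.univ := by
      rw [← scopeOf_insert, huniv, Finset.eq_univ_iff_forall]
      intro i
      obtain ⟨v, rfl⟩ := hφ.2 i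
      exact Finset.mem_biUnion.2 ⟨v, Finset.mem_univ v, Finset.mem_insert_self _ _⟩
    have hprod : evidenceProd G data p q = fun z => evidenceTable G data p q (φ r) z *
        ∏ v ∈ V, evidenceTable G data p q (φ v) z := by
      funext z
      rw [← Finset.prod_insert (f := fun v => evidenceTable G data p q (φ v) z) hr, huniv]
      exact (Function.Bijective.prod_comp hφ fun i => evidenceTable G data p q i z).symm
    convert r1 using 1
    rw [hprod, ← marg_mul_left (dependsOnly_evidenceTable G data p q (φ r))
      Finset.sdiff_disjoint, ← hscope, Finset.union_sdiff_left]
  · have hn : V.card + 1 = n := by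
      rw [← Finset.card_insert_of_notMem hr, huniv, Finset.card_univ, Fintype.card_of_bijective hφ,
        Fintype.card_fin]
    have h0 : 0 < (t + 1) * (k + 1) := by positivity
    generalize (t + 1) * (k + 1) = B at *
    have h1 : (5000 * V.card + 10) * B + 4000 * B ≤ 9000 * (n * B) := by
      rw [← hn]
      nlinarith
    omega

/-! ### The answer of the query -/

omit [∀ i, LinearOrder (D i)] in
theorem sumProduct_eq_sum {r : ℕ} (M : GraphicalModel D r) (A : Set (Assignment D))
    (F : Assignment D → ℝ) (h1 : ∀ z ∈ A, F z = ∏ j, M.f j z) (h2 : ∀ z ∉ A, F z = 0) :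
    M.sumProduct A = ∑ z, F z := by
  classical
  refine Finset.sum_congr rfl fun z _ => ?_
  split_ifs with h
  · exact (h1 z h).symm
  · exact (h2 z h).symm

omit [∀ i, Fintype (D i)] in
theorem prod_consistent_of_mem (G : Digraph (Fin n)) {p : PTuple D} {z : Assignment D}
    (h : z ∈ p.ext) : ∏ i, consistent p (family G i) z = 1 := by
  refine Finset.prod_eq_one fun i _ => if_pos ?_
  rw [PTuple.eq_proj_iff (p.dom_restrict _)]
  intro j hj
  rw [Finset.mem_inter] at hj
  rw [PTuple.restrict_apply, if_pos hj.1]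
  exact h j (PTuple.mem_dom.1 hj.2)

omit [∀ i, Fintype (D i)] in
theorem prod_consistent_of_notMem (G : Digraph (Fin n)) {p : PTuple D} {z : Assignment D}
    (h : z ∉ p.ext) : ∏ i, consistent p (family G i) z = 0 := by
  simp only [PTuple.ext, Set.mem_ofPred_eq, not_forall] at h
  obtain ⟨i, hi, hne⟩ := h
  refine Finset.prod_eq_zero (Finset.mem_univ i) (if_neg fun h => hne ?_)
  have hfam : i ∈ family G i := Finset.mem_insert_self _ _
  rw [PTuple.eq_proj_iff (p.dom_restrict _)] at h
  rw [← h i (Finset.mem_inter.2 ⟨hfam, PTuple.mem_dom.2 hi⟩), PTuple.restrict_apply, if_pos hfam]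

open Classical in
omit [∀ i, Fintype (D i)] in
-- Evidence on a variable is imposed at every family that contains it; as the indicators are 0 or 1,
-- the repetition is harmless.
theorem evidenceProd_eq (G : Digraph (Fin n)) (data : List (Assignment D)) (p q : PTuple D)
    (z : Assignment D) : evidenceProd G data p q z =
      if z ∈ p.ext ∩ q.ext then ∏ i, (empBN G data).f i z else 0 := by
  simp only [evidenceProd, evidenceTable, Finset.prod_mul_distrib]
  split_ifs with h
  · rw [prod_consistent_of_mem G h.1, prod_consistent_of_mem G h.2, mul_one, mul_one]
  · rw [Set.mem_inter_iff, not_and_or] at h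
    rcases h with h | h
    · rw [prod_consistent_of_notMem G h, mul_zero, zero_mul]
    · rw [prod_consistent_of_notMem G h, mul_zero]

theorem marg_evidenceProd (G : Digraph (Fin n)) (data : List (Assignment D)) (p q : PTuple D)
    (X : Finset (Fin n)) (z : Assignment D) :
    marg (Finset.univ \ X) (evidenceProd G data p q) z =
      (empBN G data).sumProduct ((z.proj X).ext ∩ (p.ext ∩ q.ext)) := by
  classical
  have hext (z' : Assignment D) :
      (∀ i ∉ Finset.univ \ X, z' i = z i) ↔ z' ∈ (z.proj X).ext := by
    rw [PTuple.mem_ext_iff, z.dom_proj, Assignment.proj_eq_proj]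
    simp [eq_comm]
  rw [sumProduct_eq_sum _ _ fun z' => if ∀ i ∉ Finset.univ \ X, z' i = z i then
    evidenceProd G data p q z' else 0]
  · exact Finset.sum_congr rfl fun _ _ => by split_ifs <;> rfl
  · intro z' hz'
    rw [if_pos ((hext z').2 hz'.1), evidenceProd_eq, if_pos hz'.2]
  · intro z' hz'
    split_ifs with h
    · rw [evidenceProd_eq, if_neg fun h' => hz' ⟨(hext z').1 h, h'⟩]
    · rfl

omit [∀ i, LinearOrder (D i)] in
theorem sumProduct_mono (G : Digraph (Fin n)) (data : List (Assignment D))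
    {A B : Set (Assignment D)} (h : A ⊆ B) :
    (empBN G data).sumProduct A ≤ (empBN G data).sumProduct B := by
  classical
  refine Finset.sum_le_sum fun z _ => ?_
  have hnn : 0 ≤ ∏ j, (empBN G data).f j z :=
    Finset.prod_nonneg fun j _ => div_nonneg (Nat.cast_nonneg _) (Nat.cast_nonneg _)
  split_ifs with h1 h2 h2
  · exact le_rfl
  · exact absurd (h h1) h2
  · exact hnn
  · exact le_rfl

omit [∀ i, Fintype (D i)] in
theorem mem_iff_bag {R : List (PTuple D × ℝ)} (hn : (R.map Prod.fst).Nodup)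
    (hpos : ∀ e ∈ R, e.2 ≠ 0) (x : PTuple D) (a : ℝ) :
    (x, a) ∈ R ↔ bag R x = a ∧ a ≠ 0 := by
  induction R with
  | nil =>
    simp only [List.not_mem_nil, bag, bagOf_nil, false_iff, not_and, not_not]
    exact fun h => h.symm
  | cons e R ih =>
    rw [List.map_cons, List.nodup_cons] at hn
    have ih' := ih hn.2 fun e he => hpos e (List.mem_cons_of_mem _ he)
    by_cases hk : e.1 = x
    · have h0 : bag R x = 0 := bagOf_eq_zero fun f hf hfk => hn.1 (by
        rw [hk, ← hfk]
        exact List.mem_map_of_mem hf)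
      have hnot : (x, a) ∉ R := fun h => hn.1 (by rw [hk]; exact List.mem_map_of_mem h)
      rw [bag_cons_of_eq hk, h0, add_zero, List.mem_cons, or_iff_left hnot]
      constructor
      · rintro rfl
        exact ⟨rfl, hpos (x, a) (by simp)⟩
      · rintro ⟨rfl, -⟩
        rw [← hk]
    · rw [bag_cons_of_ne hk, List.mem_cons, or_iff_right (by rintro rfl; exact hk rfl), ih']

omit [∀ i, Fintype (D i)] in
-- With `z₀` at hand, every tuple over `S` is a projection of a full assignment, so it suffices to
-- compare values there.
theorem isRelation_of_bag {S : Finset (Fin n)} {R : List (PTuple D × ℝ)} {g : PTuple D → ℝ}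
    (z₀ : Assignment D) (hn : (R.map Prod.fst).Nodup) (hdom : ∀ e ∈ R, e.1.dom = S)
    (hpos : ∀ e ∈ R, e.2 ≠ 0) (hg : ∀ z : Assignment D, g (z.proj S) = bag R (z.proj S)) :
    IsRelation S g R := by
  refine ⟨hn, fun x a => ⟨fun h => ?_, fun ⟨h1, h2, h3⟩ => ?_⟩⟩
  · have hx := hdom _ h
    obtain ⟨z, hz, -⟩ := x.exists_extension z₀
    rw [show x.dom = S from hx] at hz
    rw [mem_iff_bag hn hpos, hz, ← hg, ← hz] at h
    exact ⟨hx, h⟩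
  · obtain ⟨z, hz, -⟩ := x.exists_extension z₀
    rw [h1] at hz
    rw [mem_iff_bag hn hpos, hz, ← hg, ← hz]
    exact ⟨h2, h3⟩

omit [∀ i, LinearOrder (D i)] [∀ i, Fintype (D i)] in
theorem bag_map_div (R : List (PTuple D × ℝ)) (b : ℝ) (k : PTuple D) :
    bag (R.map fun e => (e.1, e.2 / b)) k = bag R k / b := by
  have h : bag (R.map fun e => (e.1, e.2 / b)) k =
      bagOf Prod.fst (fun e => e.2 * b⁻¹) R k :=
    bagOf_congr _ (fun _ _ => rfl) fun e _ => div_eq_mul_inv e.2 b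
  rw [h, bagOf_mul (val' := Prod.snd) fun _ _ _ => rfl, div_eq_mul_inv]

omit [∀ i, LinearOrder (D i)] [∀ i, Fintype (D i)] in
theorem bagOf_restrict_empty (R : List (PTuple D × ℝ)) (z : Assignment D) :
    bagOf (fun e => e.1.restrict ∅) Prod.snd R (z.proj ∅) = (R.map Prod.snd).sum := by
  have h (p : PTuple D) : p.restrict ∅ = z.proj ∅ := by
    funext i
    simp [PTuple.restrict_apply, Assignment.proj]
  simp [bagOf, h]

theorem Represents.total_eq {G : Digraph (Fin n)} {data : List (Assignment D)} {p : PTuple D}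
    {S : Finset (Fin n)} {R : List (PTuple D × ℝ)} (z₀ : Assignment D)
    (h : Represents S (marg (Finset.univ \ S) (evidenceProd G data p p)) R) :
    (R.map Prod.snd).sum = (empBN G data).sumProduct p.ext := by
  rw [← bagOf_restrict_empty R z₀, bagOf_restrict_eq_marg (Finset.empty_subset S) h.dom,
    ← funext h.val, marg_marg (by simpa using Finset.disjoint_sdiff), Finset.sdiff_empty,
    Finset.union_sdiff_of_subset (Finset.subset_univ S)]
  have := marg_evidenceProd G data p p ∅ z₀
  rw [Finset.sdiff_empty] at this
  rw [this]
  congr 1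
  ext z
  have : z ∈ (z₀.proj ∅).ext := fun i hi => absurd rfl hi
  simp [this]

theorem IsJoinTree.eval_main {ι : Type} [Fintype ι] [DecidableEq ι] {G : Digraph (Fin n)}
    {φ : ι → Fin n} {r : ι} {x : Val D} (h : IsJoinTree G φ r x)
    {t k : ℕ} (ht : t ≤ 2 ^ k) (data : List (Assignment D)) (hdata : data.length = t)
    (z₀ : Assignment D) (q : Query D) (hq : q.target ⊆ family G (φ r)) :
    ∃ l c, prog.Runs (.cons (encodeData data) (.cons x (encodeQuery q))) (encodeRelation l) c ∧
      IsRelation q.target ((empBN G data).answer q) l ∧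
      c ≤ 20000 * (n * ((t + 1) * (k + 1))) := by
  obtain ⟨c₀, e0, hc0⟩ := eval_ones data
  have hn : 1 ≤ n := (Nat.zero_le _).trans_lt (φ r).isLt
  have hB : t + 1 ≤ n * ((t + 1) * (k + 1)) :=
    (Nat.le_mul_of_pos_right _ (by omega)).trans (Nat.le_mul_of_pos_left _ hn)
  have hB' : (t + 1) * (k + 1) ≤ n * ((t + 1) * (k + 1)) := Nat.le_mul_of_pos_left _ hn
  have hval {S : Finset (Fin n)} (hS : q.target ⊆ S) (F : Assignment D → ℝ) :
      marg (S \ q.target) (marg (Finset.univ \ S) F) = marg (Finset.univ \ q.target) F := by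
    rw [marg_marg]
    · congr 1
      ext i
      have := @hS i
      simp only [Finset.mem_union, Finset.mem_sdiff, Finset.mem_univ, true_and]
      tauto
    · rw [Finset.disjoint_left]
      intro i h1 h2
      exact (Finset.mem_sdiff.1 h2).2 (Finset.mem_sdiff.1 h1).1
  obtain ⟨X, w, y⟩ := q
  cases y with
  | none =>
    -- The context always holds two tuples; without a condition, the event is used twice.
    obtain ⟨R, c₁, e1, r1, l1, hc1⟩ := h.eval ht data hdata.le w w
    obtain ⟨M, c₂, e2, s2, l2, r2, hc2⟩ := r1.eval_marginal ht hq l1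
    refine ⟨M, _, .call (.var rfl) rfl (.bind (.call (.op1 (.var rfl) rfl) rfl e0)
      (.bind (.op1 (.op1 (.var rfl) rfl) rfl) (.bind (.op1 (.op1 (.var rfl) rfl) rfl)
      (.bind (.op1 (.op1 (.var rfl) rfl) rfl) (.bind (.op1 (.op1 (.var rfl) rfl) rfl)
      (.ite_false (.var rfl) (.call (.op2 (.call (.op2 (.var rfl) (.op2 (.var rfl)
        (.op2 (.var rfl) (.var rfl) rfl) rfl) rfl) rfl e1) (.op1 (.var rfl) rfl) rfl)
        rfl e2))))))), ?_, ?_⟩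
    · refine isRelation_of_bag z₀ r2.nodup r2.dom (fun e he => (r2.pos e he).ne') fun z => ?_
      rw [← r2.val, hval hq, marg_evidenceProd, Set.inter_self]
      rfl
    · omega
  | some y =>
    obtain ⟨R, c₁, e1, r1, l1, hc1⟩ := h.eval ht data hdata.le w y
    obtain ⟨M, c₂, e2, s2, l2, r2, hc2⟩ := r1.eval_marginal ht hq l1
    obtain ⟨Z, c₃, e3, r3, l3, hc3⟩ := h.eval ht data hdata.le y y
    obtain ⟨c₄, e4, hc4⟩ := eval_total Z
    have hZ := r3.total_eq z₀
    have hval' (z : Assignment D) : bag M (z.proj X) =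
        (empBN G data).sumProduct ((z.proj X).ext ∩ w.ext ∩ y.ext) := by
      rw [← r2.val, hval hq, marg_evidenceProd, Set.inter_assoc]
    -- A row of the numerator has a positive value, which is at most the denominator.
    have hne : M ≠ [] → (Z.map Prod.snd).sum ≠ 0 := by
      intro hM
      obtain ⟨e, he⟩ := List.exists_mem_of_ne_nil M hM
      obtain ⟨z, hz, -⟩ := e.1.exists_extension z₀
      rw [r2.dom e he] at hz
      have hbag := ((mem_iff_bag r2.nodup (fun e he => (r2.pos e he).ne') e.1 e.2).1 he).1
      rw [hz, hval'] at hbag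
      rw [hZ]
      refine ((r2.pos e he).trans_le ?_).ne'
      rw [← hbag]
      exact sumProduct_mono G data Set.inter_subset_right
    obtain ⟨c₅, e5, hc5⟩ := eval_divide M _ hne
    refine ⟨_, _, .call (.var rfl) rfl (.bind (.call (.op1 (.var rfl) rfl) rfl e0)
      (.bind (.op1 (.op1 (.var rfl) rfl) rfl) (.bind (.op1 (.op1 (.var rfl) rfl) rfl)
      (.bind (.op1 (.op1 (.var rfl) rfl) rfl) (.bind (.op1 (.op1 (.var rfl) rfl) rfl)
      (.ite_true (.var rfl) nofun (.bind (.call (.op2 (.call (.op2 (.var rfl) (.op2 (.var rfl)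
        (.op2 (.var rfl) (.var rfl) rfl) rfl) rfl) rfl e1) (.op1 (.var rfl) rfl) rfl)
        rfl e2) (.call (.op2 (.var rfl) (.call (.call (.op2 (.var rfl) (.op2 (.var rfl)
        (.op2 (.var rfl) (.var rfl) rfl) rfl) rfl) rfl e3) rfl e4) rfl) rfl e5)))))))), ?_, ?_⟩
    · refine isRelation_of_bag z₀ (by rw [List.map_map]; exact r2.nodup) (fun e he => ?_)
        (fun e he => ?_) fun z => ?_
      · obtain ⟨f, hf, rfl⟩ := List.mem_map.1 he
        exact r2.dom f hf
      · obtain ⟨f, hf, rfl⟩ := List.mem_map.1 he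
        exact div_ne_zero (r2.pos f hf).ne' (hne (List.ne_nil_of_mem hf))
      · rw [bag_map_div, hval', hZ]
        rfl
    · omega

end

end EmpBN

namespace EmpBN

noncomputable section

variable {n : ℕ} {D : Fin n → Type}

/-! ### Encodings of hypertree decompositions of width one -/

/-- If every edge that leaves `V` ends in `p`, then a connected set of vertices that meets `V` and
its complement contains `p`. -/
theorem mem_of_preconnected {ι : Type} {T : SimpleGraph ι} {A V : Set ι} {p u v : ι}
    (hA : (T.induce A).Preconnected) (hV : ∀ a ∈ V, ∀ b ∉ V, T.Adj a b → b = p)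
    (hv : v ∈ A) (hvV : v ∈ V) (hu : u ∈ A) (huV : u ∉ V) : p ∈ A := by
  obtain ⟨w⟩ := hA ⟨v, hv⟩ ⟨u, hu⟩
  obtain ⟨d, -, h1, h2⟩ := w.exists_boundary_dart {a | a.1 ∈ V} hvV huV
  rw [← hV d.fst.1 h1 d.snd.1 h2 d.adj]
  exact d.snd.2

theorem mem_scopeOf {ι : Type} {G : Digraph (Fin n)} {φ : ι → Fin n} {V : Finset ι} {i : Fin n} :
    i ∈ scopeOf G φ V ↔ ∃ v ∈ V, i ∈ family G (φ v) :=
  Finset.mem_biUnion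

/-- A vertex below a child `c` of `p` is recognized by its path from the root, which begins with the
path `w` to `p` followed by `c`; this gives disjointness. Edges leave `V` only from a child to `p`,
so `mem_of_preconnected` turns running intersection into the two separator conditions of
`JoinForest`. -/
theorem joinForest_of_encodesForest {ι : Type} [DecidableEq ι] {G : Digraph (Fin n)}
    {φ : ι → Fin n} {T : SimpleGraph ι} (hT : T.IsTree)
    (hrun : ∀ i, (T.induce {v | i ∈ family G (φ v)}).Preconnected)
    {L : ι → Val D → Prop} (hL : ∀ v a, L v a → a = label G (φ v)) {r p : ι} {cs : List ι}
    {x : Val D} (h : EncodesForest T L p cs x) :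
    ∀ w : T.Walk r p, w.IsPath → (∀ c ∈ cs, T.Adj p c ∧ c ∉ w.support) → cs.Nodup →
      ∃ V : Finset ι, JoinForest G φ (family G (φ p)) x V ∧
        (∀ v ∈ V, ∀ q : T.Walk r v, q.IsPath → ∃ c ∈ cs, w.support ++ [c] <+: q.support) ∧
        (∀ v ∈ V, ∀ u, T.Adj v u → u ∈ V ∨ v ∈ cs ∧ u = p) ∧ ∀ c ∈ cs, c ∈ V := by
  induction h with
  | nil =>
    intro w _ _ _
    exact ⟨∅, .nil, by simp, by simp, by simp⟩
  | @cons p c cs ds a x y hds hmem ha hx hy ihx ihy =>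
    intro w hw hcs hnodup
    obtain ⟨hpc, hcw⟩ := hcs c (by simp)
    have hw' : (w.concat hpc).IsPath := hw.concat hcw hpc
    obtain ⟨V, hV, hVp, hVc, hdV⟩ := ihx (w.concat hpc) hw' (fun d hd => by
      obtain ⟨hcd, hdp⟩ := (hmem d).1 hd
      refine ⟨hcd, fun hdw => hdp ?_⟩
      -- By acyclicity, the only neighbour of `c` on the path to `c` is the vertex before it, namely
      -- `p`.
      rw [hT.isAcyclic.eq_penultimate_of_adj_end hw' hcd hdw, SimpleGraph.Walk.penultimate_concat]) hds
    obtain ⟨hcn, hnodup⟩ := List.nodup_cons.1 hnodup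
    obtain ⟨W, hW, hWp, hWc, hcW⟩ := ihy w hw (fun d hd => hcs d (List.mem_cons_of_mem _ hd)) hnodup
    have huniq (q : T.Walk r c) (hq : q.IsPath) : q = w.concat hpc :=
      (hT.existsUnique_path r c).unique hq hw'
    have hcV : c ∉ V := fun hc => by
      obtain ⟨d, -, hd⟩ := hVp c hc _ hw'
      have := hd.length_le
      simp at this
    have hVp' : ∀ v ∈ insert c V, ∀ q : T.Walk r v, q.IsPath →
        w.support ++ [c] <+: q.support := by
      intro v hv q hq
      rcases Finset.mem_insert.1 hv with rfl | hv
      · rw [huniq q hq, SimpleGraph.Walk.support_concat]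
      · obtain ⟨d, -, hd⟩ := hVp v hv q hq
        rw [SimpleGraph.Walk.support_concat] at hd
        exact (List.prefix_append _ _).trans hd
    have hdisj : Disjoint (insert c V) W := by
      refine Finset.disjoint_left.2 fun v hv hvW => ?_
      obtain ⟨q, hq, -⟩ := hT.existsUnique_path r v
      obtain ⟨d, hd, hdq⟩ := hWp v hvW q hq
      -- Two prefixes of equal length coincide, so a common vertex would make `c` occur twice among
      -- the children.
      have := List.prefix_of_prefix_length_le (hVp' v hv q hq) hdq (by simp)
      have := this.eq_of_length (by simp)
      simp only [List.append_cancel_left_eq, List.cons.injEq, and_true] at this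
      exact hcn (this ▸ hd)
    have hnotMem : ∀ F : Finset ι, (∀ v ∈ F, ∀ q : T.Walk r v, q.IsPath →
        ∃ c, w.support ++ [c] <+: q.support) → p ∉ F := fun F hF hp => by
      obtain ⟨d, hd⟩ := hF p hp w hw
      have := hd.length_le
      simp at this
    have hpV : p ∉ V := hnotMem V fun v hv q hq => ⟨c, hVp' v (Finset.mem_insert_of_mem hv) q hq⟩
    have hclosed : ∀ v ∈ insert c V, ∀ u, T.Adj v u → u ∈ insert c V ∨ v = c ∧ u = p := by
      intro v hv u hvu
      rcases Finset.mem_insert.1 hv with rfl | hv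
      · by_cases hup : u = p
        · exact .inr ⟨rfl, hup⟩
        · exact .inl (Finset.mem_insert_of_mem (hdV u ((hmem u).2 ⟨hvu, hup⟩)))
      · rcases hVc v hv u hvu with h | ⟨-, rfl⟩
        · exact .inl (Finset.mem_insert_of_mem h)
        · exact .inl (Finset.mem_insert_self _ _)
    refine ⟨insert c V ∪ W, ?_, ?_, ?_, ?_⟩
    · rw [hL c a ha]
      refine .cons hV hW hcV hdisj (fun i hi => ?_) fun i hi => ?_
      · obtain ⟨hi, hip⟩ := Finset.mem_inter.1 hi
        obtain ⟨v, hv, hiv⟩ := mem_scopeOf.1 hi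
        refine mem_of_preconnected (hrun i) (V := V) (p := c) (fun a ha b hb hab => ?_)
          hiv hv hip hpV
        exact ((hVc a ha b hab).resolve_left hb).2
      · obtain ⟨hi, hiW⟩ := Finset.mem_inter.1 hi
        obtain ⟨v, hv, hiv⟩ := mem_scopeOf.1 hi
        obtain ⟨u, hu, hiu⟩ := mem_scopeOf.1 hiW
        refine mem_of_preconnected (hrun i) (V := (insert c V : Finset ι)) (p := p)
          (fun a ha b hb hab => ?_) hiv hv hiu (Finset.disjoint_right.1 hdisj hu)
        exact ((hclosed a ha b hab).resolve_left hb).2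
    · intro v hv q hq
      rcases Finset.mem_union.1 hv with hv | hv
      · exact ⟨c, by simp, hVp' v hv q hq⟩
      · obtain ⟨d, hd, h⟩ := hWp v hv q hq
        exact ⟨d, List.mem_cons_of_mem _ hd, h⟩
    · intro v hv u hvu
      rcases Finset.mem_union.1 hv with hv | hv
      · rcases hclosed v hv u hvu with h | ⟨rfl, h⟩
        · exact .inl (Finset.mem_union_left _ h)
        · exact .inr ⟨by simp, h⟩
      · rcases hWc v hv u hvu with h | ⟨h, h'⟩
        · exact .inl (Finset.mem_union_right _ h)
        · exact .inr ⟨List.mem_cons_of_mem _ h, h'⟩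
    · intro d hd
      rcases List.mem_cons.1 hd with rfl | hd
      · exact Finset.mem_union_left _ (Finset.mem_insert_self _ _)
      · exact Finset.mem_union_right _ (hcW d hd)

theorem isJoinTree_of_encodesTree {ι : Type} [Fintype ι] [DecidableEq ι] {G : Digraph (Fin n)}
    {φ : ι → Fin n} (hφ : φ.Bijective) {T : SimpleGraph ι} (hT : T.IsTree)
    (hrun : ∀ i, (T.induce {v | i ∈ family G (φ v)}).Preconnected)
    {L : ι → Val D → Prop} (hL : ∀ v a, L v a → a = label G (φ v)) {r : ι} {x : Val D}
    (h : EncodesTree T L r x) : IsJoinTree G φ r x := by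
  obtain ⟨cs, a, y, hnodup, hmem, ha, hy, rfl⟩ := h
  obtain ⟨V, hV, hVp, hVc, hcV⟩ := joinForest_of_encodesForest hT hrun hL hy .nil .nil
    (fun c hc => ⟨(hmem c).1 hc, by simpa using ((hmem c).1 hc).ne'⟩) hnodup
  refine ⟨hφ, y, V, by rw [hL r a ha], hV, fun hr => ?_, ?_⟩
  · obtain ⟨c, -, hc⟩ := hVp r hr .nil .nil
    have := hc.length_le
    simp at this
  · rw [Finset.eq_univ_iff_forall]
    -- The set `insert r V` is closed under adjacency, and `T` is connected.
    by_contra! hu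
    obtain ⟨u, hu⟩ := hu
    obtain ⟨w⟩ := hT.connected r u
    obtain ⟨d, -, h1, h2⟩ := w.exists_boundary_dart (insert r V : Finset ι)
      (by simp) (by simpa using hu)
    refine h2 ?_
    rcases Finset.mem_insert.1 h1 with h | h
    · exact Finset.mem_insert_of_mem (hcV _ ((hmem _).2 (h ▸ d.adj)))
    · rcases hVc _ h _ d.adj with h' | ⟨-, h'⟩
      · exact Finset.mem_insert_of_mem h'
      · exact Finset.mem_insert.2 (.inl h')

/-- In a hypertree decomposition of width one, the functions belong to different vertices. -/
theorem HypertreeDecomposition.eq_of_mem {r : ℕ} {M : GraphicalModel D r} {ι : Type} [Fintype ι]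
    {τ : HypertreeDecomposition M ι} (hτ : τ.width = 1) {v : ι} {i j : Fin r} (hi : i ∈ τ.ψ v)
    (hj : j ∈ τ.ψ v) : i = j :=
  Finset.card_le_one.1 ((Finset.le_sup (f := fun v => (τ.ψ v).card) (Finset.mem_univ v)).trans_eq
    hτ) i hi j hj

theorem IsRootedDecomposition.exists_isJoinTree {G : Digraph (Fin n)} {data : List (Assignment D)}
    {X : Finset (Fin n)} {x : Val D} (h : IsRootedDecomposition G data X x) :
    ∃ (m : ℕ) (φ : Fin m → Fin n) (r : Fin m), IsJoinTree G φ r x ∧ X ⊆ family G (φ r) := by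
  obtain ⟨m, τ, r, hm, hτ, hX, hx⟩ := h
  choose g hg using fun j => (τ.exists_unique j).exists
  have hinj : g.Injective := fun i j hij => τ.eq_of_mem hτ (hg i) (hij ▸ hg j)
  have hcard : n ≤ m := by simpa using Fintype.card_le_of_injective g hinj
  -- The bound on the number of vertices excludes vertices without a function, so `g` is a
  -- bijection.
  obtain rfl : m = n := le_antisymm hm hcard
  obtain ⟨φ, hφg, hgφ⟩ := (Function.bijective_iff_has_inverse).1
    (Finite.injective_iff_bijective.1 hinj)
  have hφ : φ.Bijective := Function.bijective_iff_has_inverse.2 ⟨g, hgφ, hφg⟩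
  have hψ (v : Fin m) : φ v ∈ τ.ψ v := by simpa only [hgφ v] using hg (φ v)
  have hχ (v : Fin m) : τ.χ v = family G (φ v) := by
    refine Finset.Subset.antisymm (fun i hi => ?_) (τ.scope_subset v _ (hψ v))
    obtain ⟨j, hj, hij⟩ := Finset.mem_biUnion.1 (τ.cover v hi)
    rwa [τ.eq_of_mem hτ (hψ v) hj]
  refine ⟨m, φ, r, isJoinTree_of_encodesTree hφ τ.isTree (fun i => ?_) (fun v a ha => ?_) hx,
    hχ r ▸ hX⟩
  · have h := τ.running_intersection i
    rwa [show {v | i ∈ τ.χ v} = {v | i ∈ family G (φ v)} by simp only [hχ]] at h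
  · obtain ⟨l, hl, hmem, rfl⟩ := ha
    have : l = [φ v] := by
      refine List.perm_singleton.1 ((List.perm_ext_iff_of_nodup hl (by simp)).2 fun j => ?_)
      rw [hmem, List.mem_singleton]
      exact ⟨fun hj => τ.eq_of_mem hτ hj (hψ v), fun h => h ▸ hψ v⟩
    rw [this, hχ]
    rfl

/-! ### Existence of decompositions -/

/-- The descent terminates because the path from the root grows at each level and stays shorter than
the number of vertices; `k` bounds what is left. -/
theorem exists_encodesForest {ι : Type} [Fintype ι] {T : SimpleGraph ι} (hT : T.IsAcyclic)
    {L : ι → Val D → Prop} (hL : ∀ v, ∃ a, L v a) {r : ι} (k : ℕ) {p : ι} (w : T.Walk r p)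
    (hw : w.IsPath) (hk : Fintype.card ι ≤ w.length + k) (cs : List ι)
    (hcs : ∀ c ∈ cs, T.Adj p c ∧ c ∉ w.support) : ∃ x, EncodesForest T L p cs x := by
  classical
  induction k generalizing p cs with
  | zero => exact absurd hw.length_lt (by omega)
  | succ k ih =>
    induction cs with
    | nil => exact ⟨_, .nil⟩
    | cons c cs ihcs =>
      obtain ⟨y, hy⟩ := ihcs fun d hd => hcs d (List.mem_cons_of_mem _ hd)
      obtain ⟨hpc, hcw⟩ := hcs c (by simp)
      have hw' : (w.concat hpc).IsPath := hw.concat hcw hpc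
      obtain ⟨a, ha⟩ := hL c
      have hmem (d : ι) : d ∈ (Finset.univ.filter fun d => T.Adj c d ∧ d ≠ p).toList ↔
          T.Adj c d ∧ d ≠ p := by simp
      obtain ⟨x, hx⟩ := ih (w.concat hpc) hw' (by simp; omega) _ fun d hd => by
        obtain ⟨hcd, hdp⟩ := (hmem d).1 hd
        refine ⟨hcd, fun hdw => hdp ?_⟩
        rw [hT.eq_penultimate_of_adj_end hw' hcd hdw, SimpleGraph.Walk.penultimate_concat]
      exact ⟨_, .cons (Finset.nodup_toList _) hmem ha hx hy⟩

theorem exists_encodesTree {ι : Type} [Fintype ι] {T : SimpleGraph ι} (hT : T.IsAcyclic)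
    {L : ι → Val D → Prop} (hL : ∀ v, ∃ a, L v a) (r : ι) : ∃ x, EncodesTree T L r x := by
  classical
  have hmem (d : ι) : d ∈ (Finset.univ.filter fun d => T.Adj r d).toList ↔ T.Adj r d := by simp
  obtain ⟨a, ha⟩ := hL r
  obtain ⟨y, hy⟩ := exists_encodesForest hT hL (Fintype.card ι) (.nil : T.Walk r r) .nil (by simp) _
    fun c hc => ⟨(hmem c).1 hc, by simpa using ((hmem c).1 hc).ne'⟩
  exact ⟨_, _, a, y, Finset.nodup_toList _, hmem, ha, hy, rfl⟩

/-- A hypertree decomposition of width one can be indexed by the functions of the model. -/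
theorem HypertreeDecomposition.exists_index_functions {r : ℕ} {M : GraphicalModel D r} {ι : Type}
    [Fintype ι] (τ : HypertreeDecomposition M ι) (hτ : τ.width = 1) [Nonempty (Fin r)] :
    ∃ σ : HypertreeDecomposition M (Fin r), (∀ j, σ.ψ j = {j}) ∧ ∀ j, M.scope j ⊆ σ.χ j := by
  choose g hg using fun j => (τ.exists_unique j).exists
  have hinj : g.Injective := fun i j hij => τ.eq_of_mem hτ (hg i) (hij ▸ hg j)
  -- Restricting the tree to the vertices that carry a function leaves an acyclic graph, which is
  -- extended to a spanning tree. Additional edges cannot destroy running intersection, and by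
  -- `cover` the lost vertices have empty clusters.
  obtain ⟨T, hle, -, hT⟩ := SimpleGraph.connected_top.exists_isTree_le_of_le_of_isAcyclic
    (le_top (a := τ.T.comap g)) (τ.isTree.isAcyclic.comap ⟨g, fun h => h⟩ hinj)
  have hex {v : ι} {i : Fin n} (hi : i ∈ τ.χ v) : ∃ j, g j = v := by
    obtain ⟨j, hj, -⟩ := Finset.mem_biUnion.1 (τ.cover v hi)
    exact ⟨j, (τ.exists_unique j).unique (hg j) hj⟩
  refine ⟨⟨T, hT, fun j => τ.χ (g j), fun j => {j}, fun j => ⟨j, by simp, by simp [eq_comm]⟩,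
    fun j k hk => ?_, fun i => ?_, fun j i hi => ?_⟩, fun j => rfl, fun j => ?_⟩
  · rw [Finset.mem_singleton.1 hk]
    exact τ.scope_subset _ _ (hg j)
  · choose f hf using fun v : {v | i ∈ τ.χ v} => hex v.2
    let F : τ.T.induce {v | i ∈ τ.χ v} →g T.induce {j | i ∈ τ.χ (g j)} :=
      ⟨fun v => ⟨f v, by rw [Set.mem_ofPred_eq, hf]; exact v.2⟩, fun {a b} hab => hle (by
        change τ.T.Adj (g (f a)) (g (f b))
        rw [hf, hf]
        exact hab)⟩
    have hF (j : {j | i ∈ τ.χ (g j)}) : F ⟨g j, j.2⟩ = j := Subtype.ext (hinj (hf ⟨g j, j.2⟩))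
    intro a b
    rw [← hF a, ← hF b]
    exact (τ.running_intersection i _ _).map F
  · obtain ⟨k, hk, hik⟩ := Finset.mem_biUnion.1 (τ.cover _ hi)
    rw [Finset.singleton_biUnion, τ.eq_of_mem hτ (hg j) hk]
    exact hik
  · exact τ.scope_subset _ _ (hg j)

theorem exists_isRootedDecomposition {G : Digraph (Fin n)} {data : List (Assignment D)}
    (h : (empBN G data).hypertreeWidth = 1) {X : Finset (Fin n)} {i : Fin n}
    (hX : X ⊆ family G i) : ∃ x : Val D, IsRootedDecomposition G data X x := by
  -- The infimum of the empty set would be 0, so width 1 is attained.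
  have hne : {w | ∃ (m : ℕ) (τ : HypertreeDecomposition (empBN G data) (Fin m)),
      τ.width = w}.Nonempty := Nat.nonempty_of_sInf_eq_succ h
  have hmem := Nat.sInf_mem hne
  rw [show sInf _ = 1 from h] at hmem
  obtain ⟨m, τ, hτ⟩ := hmem
  have : Nonempty (Fin n) := ⟨i⟩
  obtain ⟨σ, hψ, hχ⟩ := τ.exists_index_functions hτ
  obtain ⟨x, hx⟩ := exists_encodesTree (L := EncodesVertex (D := D) G σ.χ σ.ψ) σ.isTree.isAcyclic
    (fun v => ⟨_, (σ.ψ v).toList, Finset.nodup_toList _, fun i => Finset.mem_toList, rfl⟩) i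
  refine ⟨x, n, σ, i, le_rfl, ?_, hX.trans (hχ i), hx⟩
  simp only [HypertreeDecomposition.width, hψ, Finset.card_singleton]
  exact Finset.sup_const Finset.univ_nonempty 1

end

end EmpBN

/-! ### The main theorem -/

theorem mainTheorem2 :
    ∃ (P : EmpBN.Program) (C : ℝ),
      ∀ (n : ℕ) (D : Fin n → Type) [∀ i, Fintype (D i)] [∀ i, LinearOrder (D i)]
        (G : Digraph (Fin n)) (data : List (EmpBN.Assignment D)),
        EmpBN.IsDAG G → 2 ≤ data.length →
        (EmpBN.empBN G data).hypertreeWidth = 1 →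
        ∀ q : EmpBN.Query D, (∃ i, q.target ⊆ EmpBN.family G i) →
          (∃ x : EmpBN.Val D, EmpBN.IsRootedDecomposition G data q.target x) ∧
          ∀ x : EmpBN.Val D, EmpBN.IsRootedDecomposition G data q.target x →
            ∃ (l : List (EmpBN.PTuple D × ℝ)) (c : ℕ),
              P.Runs (.cons (EmpBN.encodeData data) (.cons x (EmpBN.encodeQuery q)))
                (EmpBN.encodeRelation l) c ∧
              EmpBN.IsRelation q.target ((EmpBN.empBN G data).answer q) l ∧
              (c : ℝ) ≤ C * ((n : ℝ) * ((data.length : ℝ) * Real.log (data.length : ℝ))) := by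
  refine ⟨EmpBN.prog, 200000, fun n D _ _ G data _ hdata hw q ⟨i, hq⟩ =>
    ⟨EmpBN.exists_isRootedDecomposition hw hq, fun x hx => ?_⟩⟩
  obtain ⟨m, φ, r, hx, hr⟩ := hx.exists_isJoinTree
  obtain ⟨z₀, -⟩ := List.exists_mem_of_length_pos (by omega : 0 < data.length)
  -- The recursion depth is `k = Nat.log 2 t + 1`, where `t = data.length`.
  obtain ⟨l, c, h1, h2, h3⟩ := hx.eval_main (Nat.lt_pow_succ_log_self one_lt_two data.length).le
    data rfl z₀ q hr
  refine ⟨l, c, h1, h2, ?_⟩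
  have ht : (2 : ℝ) ≤ data.length := by exact_mod_cast hdata
  have hlog2 : (1 / 2 : ℝ) ≤ Real.log 2 := by linarith [Real.log_two_gt_d9]
  have hlog : (1 / 2 : ℝ) ≤ Real.log data.length :=
    hlog2.trans (Real.log_le_log two_pos ht)
  have hk : (Nat.log 2 data.length : ℝ) ≤ 2 * Real.log data.length := by
    have h : ((2 ^ Nat.log 2 data.length : ℕ) : ℝ) ≤ data.length := by
      exact_mod_cast Nat.pow_log_le_self 2 (by omega)
    have := Real.log_le_log (by positivity) h
    rw [Nat.cast_pow, Real.log_pow, Nat.cast_ofNat] at this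
    nlinarith [Nat.cast_nonneg (α := ℝ) (Nat.log 2 data.length)]
  -- From `t ≥ 2` follows `t + 1 ≤ 3/2 * t`, and from `log t ≥ 1/2` follows `2 ≤ 4 * log t`. The
  -- total factor is `20000 * 9 ≤ 200000`.
  have hbound : ((data.length : ℝ) + 1) * ((Nat.log 2 data.length : ℝ) + 2) ≤
      (3 / 2 * data.length) * (6 * Real.log data.length) := by
    gcongr <;> linarith
  have h3' : (c : ℝ) ≤ 20000 * ((n : ℝ) *
      (((data.length : ℝ) + 1) * ((Nat.log 2 data.length : ℝ) + 2))) := by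
    have := (Nat.cast_le (α := ℝ)).2 h3
    push_cast at this
    refine this.trans_eq ?_
    ring
  calc (c : ℝ) ≤ _ := h3'
    _ ≤ 20000 * ((n : ℝ) * ((3 / 2 * data.length) * (6 * Real.log data.length))) := by gcongr
    _ ≤ 200000 * ((n : ℝ) * ((data.length : ℝ) * Real.log (data.length : ℝ))) := by
      have : 0 ≤ (n : ℝ) * ((data.length : ℝ) * Real.log (data.length : ℝ)) := by positivity
      nlinarith
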